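/- Let $N\ge 2$, let $\Omega\subset\mathbb R^N$ be a bounded open set (for instance a bounded $C^2$ domain), and let $K:\mathbb R^N\setminus\{0\}\to(0,+\infty)$ satisfy $$\int_{\mathbb R^N}\min\{|x|^2,1\}K(x)\,dx<+\infty\qquad\text{and}\qquad K(x)\ge K(y)\ \text{ whenever } |x|\le|y|.$$ Put $$s_0=\sup\Big\{s\ge 0\ :\ \lim_{r\to0^+}r^{2s}\int_{B_r(0)^c}K(y)\,dy=+\infty\Big\},\qquad l_\infty=\liminf_{r\to0^+}r^{2s_0}\int_{B_r(0)^c}K(y)\,dy\in[0,\infty],$$ and assume $s_0\in(0,1]$. Let $2^*(s_0)=\frac{2N}{N-2s_0}$, with the convention $2^*(s_0)=\infty$ if $N=2s_0$. Let $X$ be the linear space of Lebesgue measurable functions $g:\mathbb R^N\to\mathbb R$ (modulo equality almost everywhere) with $g|_\Omega\in L^2(\Omega)$ and $$\|g\|_X=\Big(\|g\|_{L^2(\Omega)}^2+\int_{\mathbb R^{2N}\setminus(\Omega^c\times\Omega^c)}(g(x)-g(y))^2K(x-y)\,dx\,dy\Big)^{1/2}<+\infty,$$ and let $X_0=\{g\in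 X: g=0 \text{ a.e. in }\Omega^c\}$. Then $(X_0,\|\cdot\|_X)$ is a Hilbert space, and: (i) if $l_\infty=0$, then for every $q\in[1,2^*(s_0))$ the embedding $X_0\hookrightarrow L^q(\Omega)$, $g\mapsto g|_\Omega$, is continuous and compact, and there is $C>0$ such that $\|g\|_{L^q(\Omega)}\le C\|g\|_X$ for all $g\in X_0$; (ii) if $l_\infty\in(0,\infty]$, then the embedding $X_0\hookrightarrow L^q(\Omega)$ is continuous for every $q\in[1,2^*(s_0)]$ and compact for every $q\in[1,2^*(s_0))$, and for every $q\in[1,2^*(s_0)]$ there is $C>0$ such that $\|g\|_{L^q(\Omega)}\le C\|g\|_X$ for all $g\in X_0$. -/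

import Mathlib

open MeasureTheory Filter Topology Set
open scoped ENNReal

/-- `ℝ^N` with its Euclidean norm and Lebesgue measure. -/
abbrev RN (N : ℕ) : Type := EuclideanSpace ℝ (Fin N)

/-- The tail `∫_{B_r(0)ᶜ} K(y) dy` of the kernel, with value in `[0, ∞]`. -/
noncomputable def kernelTail {N : ℕ} (K : RN N → ℝ) (r : ℝ) : ℝ≥0∞ :=
  ∫⁻ y in (Metric.ball (0 : RN N) r)ᶜ, ENNReal.ofReal (K y)

/-- The scaled tail `r^{2s} ∫_{B_r(0)ᶜ} K(y) dy`. -/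
noncomputable def scaledTail {N : ℕ} (K : RN N → ℝ) (s r : ℝ) : ℝ≥0∞ :=
  ENNReal.ofReal (r ^ (2 * s)) * kernelTail K r

/-- `s₀ = sup {s ≥ 0 | lim_{r → 0⁺} r^{2s} ∫_{B_r(0)ᶜ} K = +∞}`. When `min{|x|²,1} K` is integrable
this set is bounded above by `1`; if the set is empty the value is `0`. -/
noncomputable def kernelOrder {N : ℕ} (K : RN N → ℝ) : ℝ :=
  sSup {s : ℝ | 0 ≤ s ∧ Tendsto (fun r : ℝ => scaledTail K s r) (𝓝[>] 0) (𝓝 ∞)}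

/-- `l_∞ = liminf_{r → 0⁺} r^{2 s₀} ∫_{B_r(0)ᶜ} K`, an element of `[0, ∞]`. -/
noncomputable def kernelLimit {N : ℕ} (K : RN N → ℝ) : ℝ≥0∞ :=
  liminf (fun r : ℝ => scaledTail K (kernelOrder K) r) (𝓝[>] 0)

/-- `2^*(s) = 2N / (N - 2s)`, an element of `[0, ∞]`; it is `∞` when `N = 2s`. -/
noncomputable def critExp (N : ℕ) (s : ℝ) : ℝ≥0∞ :=
  ENNReal.ofReal (2 * N) / ENNReal.ofReal (N - 2 * s)

/-- The region `ℝ^{2N} \ (Ωᶜ × Ωᶜ)`. -/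
def crossRegion {N : ℕ} (Ω : Set (RN N)) : Set (RN N × RN N) :=
  (Ωᶜ ×ˢ Ωᶜ)ᶜ

/-- The measure `K(x - y) dx dy` on `ℝ^{2N} \ (Ωᶜ × Ωᶜ)`. -/
noncomputable def kernelMeasure {N : ℕ} (K : RN N → ℝ) (Ω : Set (RN N)) :
    Measure (RN N × RN N) :=
  ((volume : Measure (RN N × RN N)).restrict (crossRegion Ω)).withDensity
    (fun p => ENNReal.ofReal (K (p.1 - p.2)))

/-- The difference `(x, y) ↦ g(x) - g(y)`. -/
def diffFn {N : ℕ} (g : RN N → ℝ) (p : RN N × RN N) : ℝ := g p.1 - g p.2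

/-- The explicit norm
`‖g‖_X = (∫_Ω g² + ∫_{ℝ^{2N} \ (Ωᶜ × Ωᶜ)} (g(x) - g(y))² K(x - y) dx dy)^{1/2}`. -/
noncomputable def normX {N : ℕ} (K : RN N → ℝ) (Ω : Set (RN N)) (g : RN N → ℝ) : ℝ :=
  Real.sqrt ((∫ x in Ω, g x ^ 2) +
    ∫ p in crossRegion Ω, (g p.1 - g p.2) ^ 2 * K (p.1 - p.2))

section aux

variable {N : ℕ} {K : RN N → ℝ} {Ω : Set (RN N)}

theorem kernelMeasure_ac : kernelMeasure K Ω ≪ (volume : Measure (RN N × RN N)) :=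
  (withDensity_absolutelyContinuous _ _).trans Measure.restrict_le_self.absolutelyContinuous

theorem diffFn_congr {f g : RN N → ℝ} (h : f =ᵐ[volume] g) :
    diffFn f =ᵐ[kernelMeasure K Ω] diffFn g := by
  apply kernelMeasure_ac.ae_eq
  have h1 := (Measure.quasiMeasurePreserving_fst (μ := (volume : Measure (RN N)))
    (ν := (volume : Measure (RN N)))).ae_eq_comp h
  have h2 := (Measure.quasiMeasurePreserving_snd (μ := (volume : Measure (RN N)))
    (ν := (volume : Measure (RN N)))).ae_eq_comp h
  filter_upwards [h1, h2] with p hp1 hp2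
  simp only [Function.comp] at hp1 hp2
  simp [diffFn, hp1, hp2]

theorem diffFn_add (f g : RN N →ₘ[volume] ℝ) :
    diffFn (f + g : RN N →ₘ[volume] ℝ) =ᵐ[kernelMeasure K Ω] diffFn f + diffFn g := by
  refine (diffFn_congr (AEEqFun.coeFn_add f g)).trans (Eventually.of_forall fun p => ?_)
  simp only [diffFn, Pi.add_apply]
  ring

theorem diffFn_smul (c : ℝ) (f : RN N →ₘ[volume] ℝ) :
    diffFn (c • f : RN N →ₘ[volume] ℝ) =ᵐ[kernelMeasure K Ω] c • diffFn f := by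
  refine (diffFn_congr (AEEqFun.coeFn_smul c f)).trans (Eventually.of_forall fun p => ?_)
  simp only [diffFn, Pi.smul_apply, smul_eq_mul]
  ring

theorem diffFn_zero :
    diffFn (0 : RN N →ₘ[volume] ℝ) =ᵐ[kernelMeasure K Ω] 0 := by
  refine (diffFn_congr AEEqFun.coeFn_zero).trans (Eventually.of_forall fun p => ?_)
  simp [diffFn]

end aux

/-- The space `X` of (classes modulo a.e. equality of) Lebesgue measurable `g : ℝ^N → ℝ` with
`g ∈ L²(Ω)` and `∫_{ℝ^{2N} \ (Ωᶜ × Ωᶜ)} (g(x) - g(y))² K(x - y) dx dy < ∞`. -/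
noncomputable def spaceX {N : ℕ} (K : RN N → ℝ) (Ω : Set (RN N)) :
    Submodule ℝ (RN N →ₘ[(volume : Measure (RN N))] ℝ) where
  carrier := {g | MemLp g 2 (volume.restrict Ω) ∧ MemLp (diffFn g) 2 (kernelMeasure K Ω)}
  zero_mem' := ⟨(memLp_congr_ae (ae_restrict_of_ae AEEqFun.coeFn_zero)).2 MemLp.zero,
    (memLp_congr_ae diffFn_zero).2 MemLp.zero⟩
  add_mem' := fun {f g} hf hg =>
    ⟨(memLp_congr_ae (ae_restrict_of_ae (AEEqFun.coeFn_add f g))).2 (hf.1.add hg.1),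
      (memLp_congr_ae (diffFn_add f g)).2 (hf.2.add hg.2)⟩
  smul_mem' := fun c f hf =>
    ⟨(memLp_congr_ae (ae_restrict_of_ae (AEEqFun.coeFn_smul c f))).2 (hf.1.const_smul c),
      (memLp_congr_ae (diffFn_smul c f)).2 (hf.2.const_smul c)⟩

/-- The space `X₀ = {g ∈ X | g = 0 a.e. in Ωᶜ}`. -/
noncomputable def spaceX0 {N : ℕ} (K : RN N → ℝ) (Ω : Set (RN N)) :
    Submodule ℝ (RN N →ₘ[(volume : Measure (RN N))] ℝ) where
  carrier := {g | g ∈ spaceX K Ω ∧ ∀ᵐ x ∂volume, x ∈ Ωᶜ → g x = 0}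
  zero_mem' := ⟨zero_mem _, by
    filter_upwards [AEEqFun.coeFn_zero (α := RN N) (β := ℝ) (μ := volume)] with x hx _
    simp [hx]⟩
  add_mem' := fun {f g} hf hg => ⟨add_mem hf.1 hg.1, by
    filter_upwards [hf.2, hg.2, AEEqFun.coeFn_add f g] with x h1 h2 h3 hx
    simp [h3, h1 hx, h2 hx]⟩
  smul_mem' := fun c f hf => ⟨Submodule.smul_mem _ c hf.1, by
    filter_upwards [hf.2, AEEqFun.coeFn_smul c f] with x h1 h3 hx
    simp [h3, h1 hx]⟩

/-- The bilinear form
`⟨g, h⟩ = ∫_Ω g h + ∫_{ℝ^{2N} \ (Ωᶜ × Ωᶜ)} (g(x) - g(y)) (h(x) - h(y)) K(x - y) dx dy`. -/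
noncomputable def innerX {N : ℕ} (K : RN N → ℝ) (Ω : Set (RN N)) (g h : RN N → ℝ) : ℝ :=
  (∫ x in Ω, g x * h x) + ∫ p, diffFn g p * diffFn h p ∂(kernelMeasure K Ω)

/-- `innerX` is an inner product on `X₀`. -/
@[reducible]
noncomputable def innerCoreX0 {N : ℕ} (K : RN N → ℝ) (Ω : Set (RN N)) :
    InnerProductSpace.Core ℝ (spaceX0 K Ω) where
  inner g h := innerX K Ω g.1 h.1
  conj_inner_symm g h := by
    simp only [innerX, mul_comm, conj_trivial]
  re_inner_nonneg g := by
    simp only [innerX, RCLike.re_to_real]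
    exact add_nonneg (integral_nonneg fun x => mul_self_nonneg _)
      (integral_nonneg fun x => mul_self_nonneg _)
  add_left f g h := by
    have e1 : (∫ x in Ω, (f + g).1 x * h.1 x) =
        (∫ x in Ω, f.1 x * h.1 x) + ∫ x in Ω, g.1 x * h.1 x := by
      refine Eq.trans ?_
        (integral_add (f.2.1.1.integrable_mul h.2.1.1) (g.2.1.1.integrable_mul h.2.1.1))
      refine integral_congr_ae ?_
      filter_upwards [ae_restrict_of_ae (AEEqFun.coeFn_add f.1 g.1)] with x hx
      have hx' : (f + g).1 x = f.1 x + g.1 x := hx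
      simp only [hx']
      ring
    have e2 : (∫ p, diffFn (f + g).1 p * diffFn h.1 p ∂(kernelMeasure K Ω)) =
        (∫ p, diffFn f.1 p * diffFn h.1 p ∂(kernelMeasure K Ω)) +
          ∫ p, diffFn g.1 p * diffFn h.1 p ∂(kernelMeasure K Ω) := by
      refine Eq.trans ?_
        (integral_add (f.2.1.2.integrable_mul h.2.1.2) (g.2.1.2.integrable_mul h.2.1.2))
      refine integral_congr_ae ?_
      filter_upwards [diffFn_add (K := K) (Ω := Ω) f.1 g.1] with p hp
      have hp' : diffFn (f + g).1 p = diffFn f.1 p + diffFn g.1 p := hp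
      simp only [hp']
      ring
    simp only [innerX, e1, e2]
    ring
  smul_left f g c := by
    have e1 : (∫ x in Ω, (c • f).1 x * g.1 x) = c * ∫ x in Ω, f.1 x * g.1 x := by
      rw [← integral_const_mul]
      refine integral_congr_ae ?_
      filter_upwards [ae_restrict_of_ae (AEEqFun.coeFn_smul c f.1)] with x hx
      have hx' : (c • f).1 x = c * f.1 x := hx
      simp only [hx']
      ring
    have e2 : (∫ p, diffFn (c • f).1 p * diffFn g.1 p ∂(kernelMeasure K Ω)) =
        c * ∫ p, diffFn f.1 p * diffFn g.1 p ∂(kernelMeasure K Ω) := by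
      rw [← integral_const_mul]
      refine integral_congr_ae ?_
      filter_upwards [diffFn_smul (K := K) (Ω := Ω) c f.1] with p hp
      have hp' : diffFn (c • f).1 p = c * diffFn f.1 p := hp
      simp only [hp']
      ring
    simp only [innerX, e1, e2, conj_trivial]
    ring
  definite g hg := by
    have h1 : 0 ≤ ∫ x in Ω, g.1 x * g.1 x := integral_nonneg fun x => mul_self_nonneg _
    have h2 : 0 ≤ ∫ p, diffFn g.1 p * diffFn g.1 p ∂(kernelMeasure K Ω) :=
      integral_nonneg fun x => mul_self_nonneg _
    have h3 : (∫ x in Ω, g.1 x * g.1 x) +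
        ∫ p, diffFn g.1 p * diffFn g.1 p ∂(kernelMeasure K Ω) = 0 := hg
    have h4 : (∫ x in Ω, g.1 x * g.1 x) = 0 := by linarith
    have h5 := (integral_eq_zero_iff_of_nonneg (fun x => mul_self_nonneg _)
      (g.2.1.1.integrable_mul g.2.1.1)).1 h4
    have h6 : g.1 =ᵐ[volume.restrict Ω] 0 := by
      filter_upwards [h5] with x hx
      exact mul_self_eq_zero.1 hx
    have h7 := ae_imp_of_ae_restrict h6
    refine Subtype.ext (AEEqFun.ext ?_)
    filter_upwards [h7, g.2.2, AEEqFun.coeFn_zero (α := RN N) (β := ℝ) (μ := volume)]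
      with x hx1 hx2 hx3
    have hx : g.1 x = 0 := by
      by_cases hx : x ∈ Ω
      · exact hx1 hx
      · exact hx2 hx
    rw [hx]
    exact hx3.symm

/-- The norm of `X₀` is `‖g‖ = ⟨g, g⟩^{1/2}`. -/
noncomputable instance instNormedX0 {N : ℕ} (K : RN N → ℝ) (Ω : Set (RN N)) :
    NormedAddCommGroup (spaceX0 K Ω) :=
  (innerCoreX0 K Ω).toNormedAddCommGroup

noncomputable instance instInnerX0 {N : ℕ} (K : RN N → ℝ) (Ω : Set (RN N)) :
    InnerProductSpace ℝ (spaceX0 K Ω) :=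
  InnerProductSpace.ofCore (innerCoreX0 K Ω).toCore

/-- `T` is the embedding `X₀ → L^q(Ω)`, `g ↦ g|_Ω`. -/
def IsEmbeddingLq {N : ℕ} (K : RN N → ℝ) (Ω : Set (RN N)) (q : ℝ≥0∞) [Fact (1 ≤ q)]
    (T : spaceX0 K Ω →L[ℝ] Lp ℝ q (volume.restrict Ω)) : Prop :=
  Function.Injective T ∧ ∀ g : spaceX0 K Ω, T g =ᵐ[volume.restrict Ω] g.1

/-- `X₀ ↪ L^q(Ω)` continuously. -/
def EmbedsContinuously {N : ℕ} (K : RN N → ℝ) (Ω : Set (RN N)) (q : ℝ≥0∞) [Fact (1 ≤ q)] :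
    Prop :=
  ∃ T : spaceX0 K Ω →L[ℝ] Lp ℝ q (volume.restrict Ω), IsEmbeddingLq K Ω q T

/-- `X₀ ↪ L^q(Ω)` continuously and compactly. -/
def EmbedsCompactly {N : ℕ} (K : RN N → ℝ) (Ω : Set (RN N)) (q : ℝ≥0∞) [Fact (1 ≤ q)] :
    Prop :=
  ∃ T : spaceX0 K Ω →L[ℝ] Lp ℝ q (volume.restrict Ω), IsEmbeddingLq K Ω q T ∧ IsCompactOperator T

/-- `‖g‖_{L^q(Ω)} ≤ C ‖g‖_X` for all `g ∈ X₀`. -/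
def SobolevInequality {N : ℕ} (K : RN N → ℝ) (Ω : Set (RN N)) (q : ℝ≥0∞) : Prop :=
  ∃ C : ℝ, 0 < C ∧ ∀ g : spaceX0 K Ω,
    eLpNorm g.1 q (volume.restrict Ω) ≤ ENNReal.ofReal (C * normX K Ω g.1)

/-! The argument averages at every scale `r` with a probability density cut out of the kernel
itself. Let `φ` be the radial profile of `K`, and let `ρ` be `min K φ(r)` normalised to mass one.
Monotonicity of `K` makes the normalising mass at least `φ(r)|B_r|` and at least the tail at `r`, so
both `ρ ≤ 1/|B_r|` and `ρ ≤ K / tail(r)` (`exists_averaging_kernel`). By Jensen, averaging a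
function against `ρ` moves it in `L²(Ω)` by at most `tail(r)^(-1/2)` times its norm in `X₀`.

Compactness in `L²`: since `s₀ > 0`, the tail blows up at the origin, so the embedding is an
operator-norm limit of averaging operators. These have bounded kernels on a finite measure space,
hence are Hilbert–Schmidt (`embedsCompactly_two`).

Sobolev inequality: if `tail(r) ≥ c r^(-2s)` for small `r` and `1/q = 1/2 - s/N`, then `|u(x)| ≤ C
(r^(-N/q) ‖u‖_q + r^s d(x)^(1/2))`, where `d(x)` is `u(x)²` plus the energy density of `u` at `x`.
Optimising over `r` gives `|u(x)|^q ≤ C ‖u‖_q^(q-2) d(x)`; integrating over `Ω` and dividing gives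
the inequality.

Exponents below the critical one use some `s < s₀`, and compactness there follows by interpolation
with `L²`. When `l_∞ > 0` the choice `s = s₀` is allowed; then `s₀ < 1`, because `r² tail(r) → 0`,
so `2s₀ < N` even for `N = 2`. -/

/-! ### Criteria for compactness of operators. -/

section CompactOperators

/-- A Hilbert–Schmidt operator is compact. -/
theorem HilbertBasis.isCompactOperator_of_summable {ι H F : Type*}
    [NormedAddCommGroup H] [InnerProductSpace ℝ H] [NormedAddCommGroup F] [NormedSpace ℝ F]
    [CompleteSpace F] (b : HilbertBasis ι ℝ H) (A : H →L[ℝ] F)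
    (hA : Summable fun i => ‖A (b i)‖ ^ 2) : IsCompactOperator A := by
  classical
  let T : Finset ι → H →L[ℝ] F := fun s => ∑ i ∈ s, (innerSL ℝ (b i)).smulRight (A (b i))
  have hT : ∀ s x, T s x = ∑ i ∈ s, inner ℝ (b i) x • A (b i) := fun s x => by
    simp [T]
  have hcomp : ∀ s, IsCompactOperator (T s) := fun s => by
    refine Finset.sum_induction (fun i => (innerSL ℝ (b i)).smulRight (A (b i)))
      (fun f : H →L[ℝ] F => IsCompactOperator f) (fun f g hf hg => hf.add hg)
      isCompactOperator_zero fun i _ => ?_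
    have h1 : IsCompactOperator (innerSL ℝ (b i) : H →L[ℝ] ℝ) :=
      isCompactOperator_of_locallyCompactSpace_dom (innerSL ℝ (b i))
    exact h1.clm_comp (ContinuousLinearMap.toSpanSingleton ℝ (A (b i)))
  refine isCompactOperator_of_tendsto (F := T) (l := atTop) ?_ (Eventually.of_forall hcomp)
  rw [Metric.tendsto_atTop]
  intro ε hε
  -- Cauchy–Schwarz and Bessel bound `‖A - T t‖` by the square root of the part of `∑ ‖A (b i)‖²`
  -- outside `t`, which explains the square.
  obtain ⟨s, hs⟩ := summable_iff_vanishing_norm.1 hA ((ε / 2) ^ 2) (by positivity)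
  refine ⟨s, fun t ht => ?_⟩
  rw [dist_comm, dist_eq_norm]
  refine lt_of_le_of_lt (ContinuousLinearMap.opNorm_le_bound _ (half_pos hε).le fun x => ?_)
    (half_lt_self hε)
  have hx : Tendsto (fun w : Finset ι => T w x) atTop (𝓝 (A x)) := by
    have h := (b.hasSum_repr x).mapL A
    simp only [map_smul, HilbertBasis.repr_apply_apply, HasSum,
      SummationFilter.unconditional_filter] at h
    simpa only [hT] using h
  have hx' : Tendsto (fun w : Finset ι => ‖T w x - T t x‖) atTop (𝓝 ‖A x - T t x‖) :=
    (hx.sub_const _).norm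
  refine le_of_tendsto hx' ?_
  filter_upwards [eventually_ge_atTop t] with w hw
  have e : T w x - T t x = ∑ i ∈ w \ t, inner ℝ (b i) x • A (b i) := by
    rw [hT, hT, ← Finset.sum_sdiff hw, add_sub_cancel_right]
  rw [e]
  have hS := hs (w \ t) (Finset.disjoint_of_subset_right ht Finset.sdiff_disjoint)
  have hB := b.orthonormal.sum_inner_products_le x (s := w \ t)
  have hCS : (∑ i ∈ w \ t, ‖inner ℝ (b i) x‖ * ‖A (b i)‖) ^ 2 ≤ (ε / 2 * ‖x‖) ^ 2 := by
    refine (Finset.sum_mul_sq_le_sq_mul_sq _ _ _).trans ?_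
    rw [mul_pow, mul_comm]
    gcongr
    exact (le_abs_self _).trans hS.le
  refine (norm_sum_le _ _).trans ?_
  simp only [norm_smul]
  exact (pow_le_pow_iff_left₀ (by positivity) (by positivity) two_ne_zero).1 hCS

/-- An operator controlled by a compact operator through an interpolation inequality is compact. -/
theorem IsCompactOperator.of_interpolation {E F G : Type*}
    [NormedAddCommGroup E] [NormedSpace ℝ E] [NormedAddCommGroup F] [NormedSpace ℝ F]
    [CompleteSpace F] [NormedAddCommGroup G] [NormedSpace ℝ G]
    {S : E →L[ℝ] G} (hS : IsCompactOperator S) (T : E →L[ℝ] F) {C a b : ℝ} (hC : 0 ≤ C)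
    (ha : 0 < a) (hb : 0 ≤ b) (h : ∀ x, ‖T x‖ ≤ C * ‖S x‖ ^ a * ‖x‖ ^ b) :
    IsCompactOperator T := by
  refine (isCompactOperator_iff_isCompact_closure_image_closedBall (𝕜₁ := ℝ) (σ₁₂ := RingHom.id ℝ)
    (T : E →ₗ[ℝ] F) one_pos).2 ?_
  have hS' : TotallyBounded (S '' Metric.closedBall 0 1) :=
    (hS.isCompact_closure_image_closedBall (f := (S : E →ₗ[ℝ] G)) 1).totallyBounded.subset
      subset_closure
  refine TotallyBounded.isCompact_of_isClosed (TotallyBounded.closure ?_) isClosed_closure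
  rw [Metric.totallyBounded_iff]
  intro ε hε
  -- Two points of the unit ball differ by at most 2 in norm, hence `2 ^ b`. A finite `δ`-net of the
  -- image under `S`, with centres in that image, then pulls back to an `ε`-net for `T`.
  obtain ⟨δ, hδ, hδε⟩ : ∃ δ > 0, C * δ ^ a * 2 ^ b < ε := by
    have h1 : Tendsto (fun δ : ℝ => C * δ ^ a * 2 ^ b) (𝓝[>] 0) (𝓝 (C * 0 ^ a * 2 ^ b)) := by
      refine Tendsto.mono_left ?_ nhdsWithin_le_nhds
      exact ((Real.continuousAt_rpow_const 0 a (Or.inr ha.le)).tendsto.const_mul C).mul_const _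
    rw [Real.zero_rpow ha.ne', mul_zero, zero_mul] at h1
    obtain ⟨δ, h2, h3⟩ := ((h1.eventually (gt_mem_nhds hε)).and self_mem_nhdsWithin).exists
    exact ⟨δ, h3, h2⟩
  obtain ⟨t, htS, htf, ht⟩ := totallyBounded_iff_subset.1 hS' _ (Metric.dist_mem_uniformity hδ)
  obtain ⟨u, hu, huf, rfl⟩ := Set.exists_subset_image_finite_and.1 ⟨t, htS, htf, rfl⟩
  refine ⟨T '' u, huf.image _, ?_⟩
  rintro _ ⟨x, hx, rfl⟩
  have hx1 := ht ⟨x, hx, rfl⟩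
  simp only [mem_iUnion, exists_prop] at hx1
  obtain ⟨_, ⟨y, hy, rfl⟩, hxy⟩ := hx1
  refine mem_iUnion₂.2 ⟨T y, ⟨y, hy, rfl⟩, ?_⟩
  have hxy' : ‖S (x - y)‖ < δ := by
    rw [map_sub, ← dist_eq_norm]; exact hxy
  rw [Metric.mem_ball, dist_eq_norm]
  change ‖T x - T y‖ < ε
  rw [← map_sub]
  refine (h _).trans_lt (lt_of_le_of_lt ?_ hδε)
  have h2 : ‖x - y‖ ≤ 2 := by
    have := norm_sub_le x y
    have h3 := mem_closedBall_zero_iff.1 hx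
    have h4 := mem_closedBall_zero_iff.1 (hu hy)
    linarith
  gcongr

/-- An integral operator with bounded kernel over a finite measure space is compact on `L²`. -/
theorem exists_isCompactOperator_integral {α : Type*} [MeasurableSpace α] {μ : Measure α}
    [IsFiniteMeasure μ] {k : α → α → ℝ} (hk : Measurable (Function.uncurry k)) {B : ℝ}
    (hB : ∀ x y, ‖k x y‖ ≤ B) :
    ∃ A : Lp ℝ 2 μ →L[ℝ] Lp ℝ 2 μ, IsCompactOperator A ∧
      ∀ f : Lp ℝ 2 μ, A f =ᵐ[μ] fun x => ∫ y, k x y * f y ∂μ := by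
  classical
  have hmem : ∀ x, MemLp (k x) 2 μ := fun x =>
    MemLp.of_bound (hk.of_uncurry_left).aestronglyMeasurable B (Eventually.of_forall (hB x))
  -- The rows of the kernel as vectors of `L²`: the operator is `f ↦ ⟨κ x, f⟩`, so linearity and
  -- bounds come from the inner product.
  let κ : α → Lp ℝ 2 μ := fun x => (hmem x).toLp (k x)
  have hin : ∀ x (f : Lp ℝ 2 μ), inner ℝ (κ x) f = ∫ y, k x y * f y ∂μ := fun x f => by
    rw [L2.inner_def]
    refine integral_congr_ae ?_
    filter_upwards [(hmem x).coeFn_toLp] with y hy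
    simp only [κ, hy, RCLike.inner_apply, conj_trivial, mul_comm]
  obtain ⟨R, hR0, hR⟩ : ∃ R, 0 ≤ R ∧ ∀ x, ‖κ x‖ ≤ R := by
    refine ⟨‖(μ.real univ) ^ ((2 : ℝ≥0∞).toReal)⁻¹ * |B|‖, norm_nonneg _, fun x => ?_⟩
    refine le_trans (Lp.norm_le_of_ae_bound (abs_nonneg B) ?_) (le_abs_self _)
    filter_upwards [(hmem x).coeFn_toLp] with y hy
    simp only [κ, hy]
    exact (hB x y).trans (le_abs_self B)
  have hbd : ∀ x (f : Lp ℝ 2 μ), ‖∫ y, k x y * f y ∂μ‖ ≤ R * ‖f‖ := fun x f => by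
    rw [← hin]
    exact (norm_inner_le_norm _ _).trans (by gcongr; exact hR x)
  have hmeas : ∀ f : Lp ℝ 2 μ, AEStronglyMeasurable (fun x => ∫ y, k x y * f y ∂μ) μ := fun f => by
    have h : StronglyMeasurable fun p : α × α => k p.1 p.2 * f p.2 :=
      hk.stronglyMeasurable.mul ((Lp.stronglyMeasurable f).comp_measurable measurable_snd)
    exact (h.integral_prod_right (f := fun x y => k x y * f y)).aestronglyMeasurable
  have hLp : ∀ f : Lp ℝ 2 μ, MemLp (fun x => ∫ y, k x y * f y ∂μ) 2 μ := fun f =>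
    MemLp.of_bound (hmeas f) _ (Eventually.of_forall fun x => hbd x f)
  let A₀ : Lp ℝ 2 μ →ₗ[ℝ] Lp ℝ 2 μ :=
    { toFun := fun f => (hLp f).toLp _
      map_add' := fun f g => by
        rw [← MemLp.toLp_add]
        refine MemLp.toLp_congr _ _ (Eventually.of_forall fun x => ?_)
        simp only [Pi.add_apply, ← hin, inner_add_right]
      map_smul' := fun c f => by
        rw [RingHom.id_apply, ← MemLp.toLp_const_smul]
        refine MemLp.toLp_congr _ _ (Eventually.of_forall fun x => ?_)
        simp only [Pi.smul_apply, ← hin, inner_smul_right, smul_eq_mul] }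
  let A : Lp ℝ 2 μ →L[ℝ] Lp ℝ 2 μ :=
    A₀.mkContinuous ((μ.real univ) ^ ((2 : ℝ≥0∞).toReal)⁻¹ * R) fun f => by
      rw [mul_assoc]
      refine Lp.norm_le_of_ae_bound (by positivity) ?_
      filter_upwards [(hLp f).coeFn_toLp] with x hx
      exact (congrArg norm hx).le.trans (hbd x f)
  have hAe : ∀ f, A f =ᵐ[μ] fun x => ∫ y, k x y * f y ∂μ := fun f => (hLp f).coeFn_toLp
  refine ⟨A, ?_, hAe⟩
  obtain ⟨w, b, -⟩ := exists_hilbertBasis ℝ (Lp ℝ 2 μ)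
  refine b.isCompactOperator_of_summable A ?_
  -- The sum of `‖A (b i)‖²` is the integral of `∑ ⟨b i, κ x⟩²`, which Bessel bounds by `‖κ x‖² ≤
  -- R²`.
  refine summable_of_sum_le (c := R ^ 2 * μ.real univ) (fun i => by positivity) fun s => ?_
  have hsq : ∀ i, ‖A (b i)‖ ^ 2 = ∫ x, ‖inner ℝ (b i) (κ x)‖ ^ 2 ∂μ := fun i => by
    rw [← real_inner_self_eq_norm_sq, L2.inner_def]
    refine integral_congr_ae ?_
    filter_upwards [hAe (b i)] with x hx
    rw [real_inner_comm (κ x), hin, hx, real_inner_self_eq_norm_sq]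
  have hint : ∀ i, Integrable (fun x => ‖inner ℝ (b i) (κ x)‖ ^ 2) μ := fun i => by
    refine ((hLp (b i)).integrable_norm_pow two_ne_zero).congr (Eventually.of_forall fun x => ?_)
    simp only [← hin, real_inner_comm]
  simp only [hsq]
  rw [← integral_finsetSum _ fun i _ => hint i]
  calc ∫ x, ∑ i ∈ s, ‖inner ℝ (b i) (κ x)‖ ^ 2 ∂μ ≤ ∫ _, R ^ 2 ∂μ := by
        refine integral_mono (integrable_finsetSum _ fun i _ => hint i) (integrable_const _)
          fun x => ?_
        refine (b.orthonormal.sum_inner_products_le (κ x)).trans ?_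
        gcongr
        exact hR x
    _ = R ^ 2 * μ.real univ := by simp [mul_comm]

end CompactOperators

/-! ### The radial kernel and its averaging densities. -/

section RadialKernel

variable {N : ℕ}

/-- The radial profile of a radially nonincreasing kernel. -/
noncomputable def kernelProfile (K : RN N → ℝ) (t : ℝ) : ℝ≥0∞ :=
  ⨆ (x : RN N) (_ : x ≠ 0 ∧ t ≤ ‖x‖), ENNReal.ofReal (K x)

/-- The radial representative of a radially nonincreasing kernel. -/
noncomputable def kernelRep (K : RN N → ℝ) (x : RN N) : ℝ≥0∞ := kernelProfile K ‖x‖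

variable {K : RN N → ℝ}

theorem kernelProfile_antitone : Antitone (kernelProfile K) := fun _ _ hst =>
  iSup₂_le fun x hx => le_iSup₂_of_le x ⟨hx.1, hst.trans hx.2⟩ le_rfl

theorem measurable_kernelRep : Measurable (kernelRep K) :=
  kernelProfile_antitone.measurable.comp measurable_norm

/-- The supremum in the profile is attained at `x` itself. Off the origin the kernel is thus an
antitone function of the norm, which is Borel measurable with no such assumption on `K`. -/
theorem kernelRep_eq (hKmono : ∀ x y, x ≠ 0 → y ≠ 0 → ‖x‖ ≤ ‖y‖ → K y ≤ K x) {x : RN N}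
    (hx : x ≠ 0) : kernelRep K x = ENNReal.ofReal (K x) :=
  le_antisymm (iSup₂_le fun y hy => ENNReal.ofReal_le_ofReal (hKmono x y hx hy.1 hy.2))
    (le_iSup₂_of_le x ⟨hx, le_rfl⟩ le_rfl)

theorem nontrivial_RN (hN : 0 < N) : Nontrivial (RN N) := by
  have : Nonempty (Fin N) := ⟨⟨0, hN⟩⟩
  infer_instance

theorem ae_ne_zero_RN (hN : 0 < N) : ∀ᵐ x : RN N, x ≠ 0 := by
  have := nontrivial_RN hN
  exact Measure.ae_ne volume 0

theorem ae_sub_ne_zero_RN (hN : 0 < N) : ∀ᵐ p : RN N × RN N, p.1 - p.2 ≠ 0 :=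
  (quasiMeasurePreserving_sub_of_right_invariant volume volume).ae (ae_ne_zero_RN hN)

theorem kernelTail_eq (hN : 0 < N)
    (hKmono : ∀ x y, x ≠ 0 → y ≠ 0 → ‖x‖ ≤ ‖y‖ → K y ≤ K x) (r : ℝ) :
    kernelTail K r = ∫⁻ y in (Metric.ball (0 : RN N) r)ᶜ, kernelRep K y := by
  refine lintegral_congr_ae (ae_restrict_of_ae ?_)
  filter_upwards [ae_ne_zero_RN hN] with y hy
  rw [kernelRep_eq hKmono hy]

/-- Outside `B_r` the weight `min(|x|², 1)` is at least `min(r², 1) > 0`. -/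
theorem kernelTail_lt_top (hKint : Integrable (fun x => min (‖x‖ ^ 2) 1 * K x) volume)
    {r : ℝ} (hr : 0 < r) : kernelTail K r < ∞ := by
  have hm : 0 < min (r ^ 2) 1 := by positivity
  have h := hKint.lintegral_lt_top
  have hle : kernelTail K r ≤ ENNReal.ofReal (min (r ^ 2) 1)⁻¹ *
      ∫⁻ x, ENNReal.ofReal (min (‖x‖ ^ 2) 1 * K x) := by
    rw [← lintegral_const_mul' _ _ ENNReal.ofReal_ne_top]
    refine (setLIntegral_mono' Metric.isOpen_ball.measurableSet.compl fun y hy => ?_).trans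
      (setLIntegral_le_lintegral _ _)
    rw [← ENNReal.ofReal_mul (by positivity)]
    rcases le_or_gt (K y) 0 with hK | hK
    · rw [ENNReal.ofReal_of_nonpos hK]; exact zero_le
    refine ENNReal.ofReal_le_ofReal ?_
    have hy' : r ≤ ‖y‖ := by simpa using hy
    have h1 : min (r ^ 2) 1 ≤ min (‖y‖ ^ 2) 1 := by gcongr
    rw [← mul_assoc, ← div_eq_inv_mul]
    exact le_mul_of_one_le_left hK.le ((one_le_div hm).2 h1)
  exact hle.trans_lt (ENNReal.mul_lt_top ENNReal.ofReal_lt_top h)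

/-- At every scale `r` there is a probability density that is bounded by `|B_r|⁻¹` and by the
kernel divided by its tail. -/
theorem exists_averaging_kernel (hN : 0 < N) (hKpos : ∀ x, x ≠ 0 → 0 < K x)
    (hKint : Integrable (fun x => min (‖x‖ ^ 2) 1 * K x) volume)
    (hKmono : ∀ x y, x ≠ 0 → y ≠ 0 → ‖x‖ ≤ ‖y‖ → K y ≤ K x) {r : ℝ} (hr : 0 < r) :
    ∃ ρ : RN N → ℝ≥0∞, Measurable ρ ∧ ∫⁻ y, ρ y = 1 ∧
      (∀ y, ρ y ≤ (volume (Metric.ball (0 : RN N) r))⁻¹) ∧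
      ∀ y, ρ y ≤ (kernelTail K r)⁻¹ * kernelRep K y := by
  have := nontrivial_RN hN
  obtain ⟨e, he⟩ := exists_norm_eq (RN N) hr.le
  have he0 : e ≠ 0 := by rintro rfl; simp at he; exact hr.ne he
  have hφ : kernelProfile K r = ENNReal.ofReal (K e) := by
    rw [← kernelRep_eq hKmono he0, kernelRep, he]
  have hφ0 : kernelProfile K r ≠ 0 := by simpa [hφ] using hKpos e he0
  have hφt : kernelProfile K r ≠ ∞ := by simp [hφ]
  -- The truncated kernel equals at least `φ(r)` on the ball and is the kernel itself outside, so
  -- its mass `M` dominates both `φ(r)|B_r|` and the tail. The density is `τ / M`.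
  set τ : RN N → ℝ≥0∞ := fun y => min (kernelRep K y) (kernelProfile K r) with hτ
  have hτm : Measurable τ := measurable_kernelRep.min measurable_const
  set M := ∫⁻ y, τ y with hM
  have hball : (volume (Metric.ball (0 : RN N) r)) ≠ 0 :=
    (Metric.measure_ball_pos volume _ hr).ne'
  have hballt : (volume (Metric.ball (0 : RN N) r)) ≠ ∞ := measure_ball_lt_top.ne
  have h1 : kernelProfile K r * volume (Metric.ball (0 : RN N) r) ≤ M := by
    rw [← setLIntegral_const]
    refine (setLIntegral_mono' Metric.isOpen_ball.measurableSet fun y hy => ?_).trans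
      (setLIntegral_le_lintegral _ _)
    exact le_min (kernelProfile_antitone (by simpa using (mem_ball_zero_iff.1 hy).le)) le_rfl
  have h2 : kernelTail K r ≤ M := by
    rw [kernelTail_eq hN hKmono]
    refine (setLIntegral_mono' Metric.isOpen_ball.measurableSet.compl fun y hy => ?_).trans
      (setLIntegral_le_lintegral _ _)
    exact le_min le_rfl (kernelProfile_antitone (by simpa using hy))
  have hM0 : M ≠ 0 := (lt_of_lt_of_le (ENNReal.mul_pos hφ0 hball) h1).ne'
  have hMt : M ≠ ∞ := by
    rw [hM, ← lintegral_add_compl τ (Metric.isOpen_ball (x := (0 : RN N)) (ε := r)).measurableSet]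
    refine (ENNReal.add_lt_top.2 ⟨?_, ?_⟩).ne
    · refine (lintegral_mono fun y => min_le_right _ _).trans_lt ?_
      rw [setLIntegral_const]
      exact ENNReal.mul_lt_top hφt.lt_top hballt.lt_top
    · refine (lintegral_mono fun y => min_le_left _ _).trans_lt ?_
      rw [← kernelTail_eq hN hKmono]
      exact kernelTail_lt_top hKint hr
  refine ⟨fun y => M⁻¹ * τ y, hτm.const_mul _, ?_, fun y => ?_, fun y => ?_⟩
  · rw [lintegral_const_mul _ hτm, ENNReal.inv_mul_cancel hM0 hMt]
  · refine (mul_le_mul_right (min_le_right _ _) _).trans ?_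
    rw [mul_comm, ← div_eq_mul_inv]
    refine ENNReal.div_le_of_le_mul' ?_
    rwa [← div_eq_mul_inv, ENNReal.le_div_iff_mul_le (Or.inl hball) (Or.inl hballt)]
  · exact mul_le_mul' (ENNReal.inv_le_inv.2 h2) (min_le_left _ _)

/-- Jensen's inequality for powers against a probability density. -/
theorem lintegral_mul_density_le_rpow {α : Type*} [MeasurableSpace α] {μ : Measure α}
    {ρ f : α → ℝ≥0∞} (hρ : Measurable ρ) (h1 : ∫⁻ y, ρ y ∂μ = 1) (hf : Measurable f)
    {q : ℝ} (hq : 1 ≤ q) :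
    ∫⁻ y, ρ y * f y ∂μ ≤ (∫⁻ y, ρ y * f y ^ q ∂μ) ^ (1 / q) := by
  have : IsProbabilityMeasure (μ.withDensity ρ) := ⟨by
    rw [withDensity_apply _ MeasurableSet.univ, setLIntegral_univ, h1]⟩
  have h := eLpNorm'_le_eLpNorm'_of_exponent_le one_pos hq (μ.withDensity ρ)
    hf.aestronglyMeasurable
  simpa [eLpNorm', lintegral_withDensity_eq_lintegral_mul _ hρ hf,
    lintegral_withDensity_eq_lintegral_mul _ hρ (hf.pow_const q)] using h

end RadialKernel

/-! ### Pointwise and integrated Sobolev inequalities. -/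

section Sobolev

variable {N : ℕ} {K : RN N → ℝ}

/-- The density `x ↦ ∫ (u(x) - u(y))² K(x - y) dy` of the energy of `u`. -/
noncomputable def energyDensity (K : RN N → ℝ) (u : RN N → ℝ) (x : RN N) : ℝ≥0∞ :=
  ∫⁻ y, ‖u x - u y‖ₑ ^ 2 * kernelRep K (x - y)

theorem measurable_energyDensity {u : RN N → ℝ} (hu : Measurable u) :
    Measurable (energyDensity K u) := by
  have h : Measurable fun p : RN N × RN N => ‖u p.1 - u p.2‖ₑ ^ 2 * kernelRep K (p.1 - p.2) :=
    (((hu.comp measurable_fst).sub (hu.comp measurable_snd)).enorm.pow_const 2).mul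
      (measurable_kernelRep.comp (measurable_fst.sub measurable_snd))
  exact h.lintegral_prod_right'

/-- Jensen replaces the mean of `|u x - u y|` by its quadratic mean, where `ρ ≤ m K` brings in the
energy density. -/
theorem lintegral_averaging_sub_sq_le {ρ : RN N → ℝ≥0∞} (hρ : Measurable ρ)
    (h1 : ∫⁻ y, ρ y = 1) {m : ℝ≥0∞} (hm : ∀ y, ρ y ≤ m * kernelRep K y)
    {u : RN N → ℝ} (hu : Measurable u) (x : RN N) :
    ∫⁻ y, ρ (x - y) * ‖u x - u y‖ₑ ≤ (m * energyDensity K u x) ^ (1 / 2 : ℝ) := by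
  have h1' : ∫⁻ y, ρ (x - y) = 1 := by rw [lintegral_sub_left_eq_self ρ x, h1]
  have hρ' : Measurable fun y => ρ (x - y) := hρ.comp (measurable_const.sub measurable_id)
  have hf : Measurable fun y => ‖u x - u y‖ₑ := (measurable_const.sub hu).enorm
  refine (lintegral_mul_density_le_rpow hρ' h1' hf one_le_two).trans ?_
  refine ENNReal.rpow_le_rpow ?_ (by norm_num)
  have hκ : Measurable fun y => kernelRep K (x - y) :=
    measurable_kernelRep.comp (measurable_const.sub measurable_id)
  rw [energyDensity, ← lintegral_const_mul _ ((hf.pow_const 2).fun_mul hκ)]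
  refine lintegral_mono fun y => ?_
  simp only [ENNReal.rpow_two]
  calc ρ (x - y) * ‖u x - u y‖ₑ ^ 2 ≤ m * kernelRep K (x - y) * ‖u x - u y‖ₑ ^ 2 := by
        gcongr; exact hm _
    _ = _ := by ring

/-- The value `u x` is its own average against `ρ (x - ·)`. Splitting off `u x - u y` leaves an
average of `u`, controlled by the height `b`, and an oscillation, controlled by the kernel. -/
theorem enorm_le_average_add_energy {ρ : RN N → ℝ≥0∞} (hρ : Measurable ρ)
    (h1 : ∫⁻ y, ρ y = 1) {b m : ℝ≥0∞} (hb : ∀ y, ρ y ≤ b) (hm : ∀ y, ρ y ≤ m * kernelRep K y)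
    {u : RN N → ℝ} (hu : Measurable u) {q : ℝ} (hq : 1 ≤ q) (x : RN N) :
    ‖u x‖ₑ ≤ (b * ∫⁻ y, ‖u y‖ₑ ^ q) ^ (1 / q) +
      (m * energyDensity K u x) ^ (1 / 2 : ℝ) := by
  have h1' : ∫⁻ y, ρ (x - y) = 1 := by rw [lintegral_sub_left_eq_self ρ x, h1]
  have hρ' : Measurable fun y => ρ (x - y) := hρ.comp (measurable_const.sub measurable_id)
  calc ‖u x‖ₑ = ∫⁻ y, ρ (x - y) * ‖u x‖ₑ := by
        rw [lintegral_mul_const _ hρ', h1', one_mul]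
    _ ≤ ∫⁻ y, (ρ (x - y) * ‖u y‖ₑ + ρ (x - y) * ‖u x - u y‖ₑ) := by
        refine lintegral_mono fun y => ?_
        rw [← mul_add]
        gcongr
        calc ‖u x‖ₑ = ‖u y + (u x - u y)‖ₑ := by rw [add_sub_cancel]
          _ ≤ _ := enorm_add_le _ _
    _ = (∫⁻ y, ρ (x - y) * ‖u y‖ₑ) + ∫⁻ y, ρ (x - y) * ‖u x - u y‖ₑ :=
        lintegral_add_left (hρ'.mul hu.enorm) _
    _ ≤ _ := by
        refine add_le_add ((lintegral_mul_density_le_rpow hρ' h1' hu.enorm hq).trans ?_)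
          (lintegral_averaging_sub_sq_le hρ h1 hm hu x)
        refine ENNReal.rpow_le_rpow ?_ (by positivity)
        rw [← lintegral_const_mul _ (hu.enorm.pow_const q)]
        exact lintegral_mono fun y => by gcongr; exact hb _

/-- Optimising over the scale. -/
theorem le_of_forall_scale_le {a A d C₁ C₂ n s q : ℝ} (hA : 0 < A) (hd : 0 < d) (hn : 0 < n)
    (hq : 0 < q) (hqs : 1 / q = 1 / 2 - s / n)
    (h : ∀ r : ℝ, 0 < r → a ≤ C₁ * r ^ (-(n / q)) * A + C₂ * r ^ s * d ^ (1 / 2 : ℝ)) :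
    a ≤ (C₁ + C₂) * (A ^ (1 - 2 / q) * d ^ (1 / q)) := by
  -- This scale makes `r^(-n/q) A` and `r^s d^(1/2)` equal, since `s + n/q = n/2`.
  have hr : 0 < (A ^ (2 : ℝ) / d) ^ (1 / n) := by positivity
  have e1 : ((A ^ (2 : ℝ) / d) ^ (1 / n)) ^ (-(n / q)) * A = A ^ (1 - 2 / q) * d ^ (1 / q) := by
    rw [← Real.rpow_mul (by positivity), Real.div_rpow (by positivity) hd.le,
      ← Real.rpow_mul hA.le, div_eq_mul_inv, ← Real.rpow_neg hd.le]
    have e : 1 / n * -(n / q) = -(1 / q) := by field_simp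
    rw [e, mul_right_comm, ← Real.rpow_add_one hA.ne', neg_neg]
    congr 2
    ring
  have e2 : ((A ^ (2 : ℝ) / d) ^ (1 / n)) ^ s * d ^ (1 / 2 : ℝ) =
      A ^ (1 - 2 / q) * d ^ (1 / q) := by
    rw [← Real.rpow_mul (by positivity), Real.div_rpow (by positivity) hd.le,
      ← Real.rpow_mul hA.le, div_eq_mul_inv, ← Real.rpow_neg hd.le, mul_assoc,
      ← Real.rpow_add hd]
    have e : 1 / n * s = s / n := by ring
    have e' : s / n = 1 / 2 - 1 / q := by linarith
    rw [e, e']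
    congr 2 <;> ring
  refine (h _ hr).trans (le_of_eq ?_)
  rw [mul_assoc, mul_assoc C₂, e1, e2]
  ring

/-- If the tail of the kernel is at least of order `r^{-2s}`, a function is controlled pointwise
by its norm in `L^{2^*(s)}` and its energy density. -/
theorem exists_pointwise_sobolev (hN : 0 < N) (hKpos : ∀ x, x ≠ 0 → 0 < K x)
    (hKint : Integrable (fun x => min (‖x‖ ^ 2) 1 * K x) volume)
    (hKmono : ∀ x y, x ≠ 0 → y ≠ 0 → ‖x‖ ≤ ‖y‖ → K y ≤ K x) {s q c r₀ : ℝ} (hs : 0 < s)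
    (hq : 2 < q) (hqs : 1 / q = 1 / 2 - s / N) (hc : 0 < c) (hr₀ : 0 < r₀)
    (hK : ∀ r, 0 < r → r < r₀ → ENNReal.ofReal (c * r ^ (-(2 * s))) ≤ kernelTail K r) :
    ∃ C : ℝ, 0 ≤ C ∧ ∀ u : RN N → ℝ, Measurable u → (∫⁻ y, ‖u y‖ₑ ^ q) ≠ 0 →
      (∫⁻ y, ‖u y‖ₑ ^ q) ≠ ∞ → ∀ x,
        ‖u x‖ₑ ^ q ≤ ENNReal.ofReal C * (∫⁻ y, ‖u y‖ₑ ^ q) ^ (1 - 2 / q) *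
          (‖u x‖ₑ ^ 2 + energyDensity K u x) := by
  have := nontrivial_RN hN
  have hq0 : 0 < q := by linarith
  have hq1 : 0 < 1 - 2 / q := by rw [sub_pos, div_lt_one hq0]; exact hq
  set v := (volume (Metric.ball (0 : RN N) 1)).toReal with hv
  have hv0 : 0 < v := ENNReal.toReal_pos (Metric.measure_ball_pos volume _ one_pos).ne'
    measure_ball_lt_top.ne
  set C₁ := v⁻¹ ^ (1 / q) with hC₁
  -- The first summand serves `r < r₀`, where the tail bound holds. The second serves `r ≥ r₀`:
  -- there `r₀^(-s) r^s ≥ 1`, and `|u x| ≤ D^(1/2)` because `D` contains `|u x|²`.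
  set C₂ := c⁻¹ ^ (1 / 2 : ℝ) + r₀ ^ (-s) with hC₂
  have hC₁0 : 0 ≤ C₁ := by positivity
  have hC₂0 : 0 ≤ C₂ := by positivity
  refine ⟨(C₁ + C₂) ^ q, by positivity, fun u hu hI0 hIt x => ?_⟩
  set I := ∫⁻ y, ‖u y‖ₑ ^ q with hI
  set D := ‖u x‖ₑ ^ 2 + energyDensity K u x with hD
  rcases eq_or_ne (u x) 0 with hux | hux
  · simp [hux, hq0]
  have hD0 : D ≠ 0 := by
    have : 0 < ‖u x‖ₑ ^ 2 := by
      have := enorm_pos.2 hux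
      positivity
    exact (this.trans_le le_self_add).ne'
  have hCpos : 0 < (C₁ + C₂) ^ q := by positivity
  rcases eq_or_ne D ∞ with hDt | hDt
  · rw [hDt, ENNReal.mul_top]
    · exact le_top
    · refine mul_ne_zero (by simpa using hCpos) ?_
      simp [ENNReal.rpow_eq_zero_iff, hI0, hIt]
  set d := D.toReal with hd
  set i := I.toReal with hi
  have hd0 : 0 < d := ENNReal.toReal_pos hD0 hDt
  have hi0 : 0 < i := ENNReal.toReal_pos hI0 hIt
  have hDd : D = ENNReal.ofReal d := (ENNReal.ofReal_toReal hDt).symm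
  have hIi : I = ENNReal.ofReal i := (ENNReal.ofReal_toReal hIt).symm
  have hA0 : 0 < i ^ (1 / q) := by positivity
  have key : |u x| ≤ (C₁ + C₂) * ((i ^ (1 / q)) ^ (1 - 2 / q) * d ^ (1 / q)) := by
    refine le_of_forall_scale_le hA0 hd0 (Nat.cast_pos.2 hN) hq0 hqs fun r hr => ?_
    rcases lt_or_ge r r₀ with hrr | hrr
    · obtain ⟨ρ, hρm, hρ1, hρb, hρK⟩ := exists_averaging_kernel hN hKpos hKint hKmono hr
      have h := enorm_le_average_add_energy hρm hρ1 hρb hρK hu (q := q) (by linarith) x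
      have hvol : (volume (Metric.ball (0 : RN N) r))⁻¹ = ENNReal.ofReal (v⁻¹ * r ^ (-(N : ℝ))) := by
        rw [Measure.addHaar_ball _ _ hr.le, finrank_euclideanSpace_fin,
          ← ENNReal.ofReal_toReal (measure_ball_lt_top (μ := volume) (x := (0 : RN N)) (r := 1)).ne,
          ← ENNReal.ofReal_mul (by positivity), ← ENNReal.ofReal_inv_of_pos (by positivity),
          Real.rpow_neg hr.le, Real.rpow_natCast, mul_inv, mul_comm]
      have htail : (kernelTail K r)⁻¹ ≤ ENNReal.ofReal (c⁻¹ * r ^ (2 * s)) := by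
        refine (ENNReal.inv_le_inv.2 (hK r hr hrr)).trans (le_of_eq ?_)
        rw [← ENNReal.ofReal_inv_of_pos (by positivity), mul_inv, Real.rpow_neg hr.le, inv_inv]
      have h' : ENNReal.ofReal |u x| ≤
          ENNReal.ofReal ((v⁻¹ * r ^ (-(N : ℝ)) * i) ^ (1 / q)) +
            ENNReal.ofReal ((c⁻¹ * r ^ (2 * s) * d) ^ (1 / 2 : ℝ)) := by
        rw [← Real.enorm_eq_ofReal_abs, ← ENNReal.ofReal_rpow_of_nonneg (by positivity)
          (by positivity), ← ENNReal.ofReal_rpow_of_nonneg (by positivity) (by positivity),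
          ENNReal.ofReal_mul (by positivity), ENNReal.ofReal_mul (q := d) (by positivity),
          ← hDd, ← hIi, ← hvol]
        refine h.trans ?_
        gcongr
        exact le_add_self
      rw [← ENNReal.ofReal_add (by positivity) (by positivity),
        ENNReal.ofReal_le_ofReal_iff (by positivity)] at h'
      refine h'.trans ?_
      have e1 : (v⁻¹ * r ^ (-(N : ℝ)) * i) ^ (1 / q) = C₁ * r ^ (-(N / q)) * i ^ (1 / q) := by
        rw [Real.mul_rpow (by positivity) hi0.le, Real.mul_rpow (by positivity) (by positivity),
          ← Real.rpow_mul hr.le]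
        congr 3
        ring
      have e2 : (c⁻¹ * r ^ (2 * s) * d) ^ (1 / 2 : ℝ) =
          c⁻¹ ^ (1 / 2 : ℝ) * r ^ s * d ^ (1 / 2 : ℝ) := by
        rw [Real.mul_rpow (by positivity) hd0.le, Real.mul_rpow (by positivity) (by positivity),
          ← Real.rpow_mul hr.le]
        congr 3
        ring
      rw [e1, e2]
      gcongr
      exact le_add_of_nonneg_right (by positivity)
    · have h : ENNReal.ofReal (|u x| ^ 2) ≤ ENNReal.ofReal d := by
        rw [← hDd, ENNReal.ofReal_pow (abs_nonneg _), ← Real.enorm_eq_ofReal_abs]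
        exact le_self_add
      rw [ENNReal.ofReal_le_ofReal_iff hd0.le] at h
      have h2 : |u x| ≤ d ^ (1 / 2 : ℝ) := by
        rw [← Real.sqrt_eq_rpow]
        exact Real.le_sqrt_of_sq_le h
      have h3 : 1 ≤ C₂ * r ^ s := by
        calc 1 = r₀ ^ (-s) * r₀ ^ s := by rw [← Real.rpow_add hr₀]; simp
          _ ≤ C₂ * r ^ s := by
            gcongr
            exact le_add_of_nonneg_left (by positivity)
      calc |u x| ≤ d ^ (1 / 2 : ℝ) := h2
        _ ≤ C₂ * r ^ s * d ^ (1 / 2 : ℝ) := le_mul_of_one_le_left (by positivity) h3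
        _ ≤ _ := le_add_of_nonneg_left (by positivity)
  have key2 := Real.rpow_le_rpow (abs_nonneg _) key hq0.le
  rw [Real.mul_rpow (by positivity) (by positivity), Real.mul_rpow (by positivity) (by positivity),
    ← Real.rpow_mul hd0.le, ← Real.rpow_mul hi0.le, ← Real.rpow_mul hi0.le, one_div,
    inv_mul_cancel₀ hq0.ne', Real.rpow_one] at key2
  have e : q⁻¹ * (1 - 2 / q) * q = 1 - 2 / q := by field_simp
  rw [e] at key2
  rw [Real.enorm_eq_ofReal_abs, ENNReal.ofReal_rpow_of_nonneg (abs_nonneg _) hq0.le, hIi, hDd,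
    ENNReal.ofReal_rpow_of_nonneg hi0.le hq1.le, ← ENNReal.ofReal_mul (by positivity),
    ← ENNReal.ofReal_mul (by positivity), mul_assoc]
  exact ENNReal.ofReal_le_ofReal key2

/-- The map `t ↦ min |t| m` is 1-Lipschitz. -/
theorem energyDensity_min_abs_le (u : RN N → ℝ) (m : ℝ) (x : RN N) :
    energyDensity K (fun y => min |u y| m) x ≤ energyDensity K u x := by
  refine lintegral_mono fun y => ?_
  gcongr
  rw [enorm_le_iff_norm_le, Real.norm_eq_abs, Real.norm_eq_abs]
  refine (abs_min_sub_min_le_max _ _ _ _).trans ?_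
  simpa using abs_abs_sub_abs_le (u x) (u y)

/-- The Sobolev inequality for functions that vanish outside a set of finite measure. -/
theorem exists_sobolev_of_tail (hN : 0 < N) (hKpos : ∀ x, x ≠ 0 → 0 < K x)
    (hKint : Integrable (fun x => min (‖x‖ ^ 2) 1 * K x) volume)
    (hKmono : ∀ x y, x ≠ 0 → y ≠ 0 → ‖x‖ ≤ ‖y‖ → K y ≤ K x) {s q c r₀ : ℝ} (hs : 0 < s)
    (hq : 2 < q) (hqs : 1 / q = 1 / 2 - s / N) (hc : 0 < c) (hr₀ : 0 < r₀)
    (hK : ∀ r, 0 < r → r < r₀ → ENNReal.ofReal (c * r ^ (-(2 * s))) ≤ kernelTail K r)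
    {Ω : Set (RN N)} (hΩm : MeasurableSet Ω) (hΩ : volume Ω ≠ ∞) :
    ∃ C : ℝ, 0 ≤ C ∧ ∀ u : RN N → ℝ, Measurable u → (∀ᵐ x, x ∈ Ωᶜ → u x = 0) →
      (∫⁻ x in Ω, ‖u x‖ₑ ^ q) ^ (2 / q) ≤
        ENNReal.ofReal C * ∫⁻ x in Ω, (‖u x‖ₑ ^ 2 + energyDensity K u x) := by
  have hq0 : 0 < q := by linarith
  have hq1 : 0 < 1 - 2 / q := by rw [sub_pos, div_lt_one hq0]; exact hq
  obtain ⟨C, hC, hP⟩ := exists_pointwise_sobolev hN hKpos hKint hKmono hs hq hqs hc hr₀ hK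
  refine ⟨C, hC, fun u hu hu0 => ?_⟩
  have hsupp : ∀ w : RN N → ℝ, (∀ᵐ x, x ∈ Ωᶜ → w x = 0) →
      ∫⁻ x, ‖w x‖ₑ ^ q = ∫⁻ x in Ω, ‖w x‖ₑ ^ q := fun w hw => by
    rw [← lintegral_add_compl _ hΩm]
    convert add_zero _
    refine (setLIntegral_congr_fun_ae hΩm.compl ?_).trans lintegral_zero
    filter_upwards [hw] with x hx hxΩ
    simp [hx hxΩ, hq0]
  -- Dividing by `I ^ (1 - 2 / q)` requires `I` finite. Truncation at height `m` ensures it, as `Ω`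
  -- has finite measure; the constant does not depend on `m`, so monotone convergence removes the
  -- truncation.
  have hbdd : ∀ m : ℕ, (∫⁻ x in Ω, ‖min |u x| (m : ℝ)‖ₑ ^ q) ^ (2 / q) ≤
      ENNReal.ofReal C * ∫⁻ x in Ω, (‖u x‖ₑ ^ 2 + energyDensity K u x) := fun m => by
    set w : RN N → ℝ := fun x => min |u x| m with hw
    have hwm : Measurable w := (measurable_norm.comp hu).min measurable_const
    have hw0 : ∀ᵐ x, x ∈ Ωᶜ → w x = 0 := by
      filter_upwards [hu0] with x hx hxΩ
      simp [hw, hx hxΩ]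
    have hwu : ∀ x, ‖w x‖ₑ ≤ ‖u x‖ₑ := fun x => by
      rw [enorm_le_iff_norm_le, Real.norm_of_nonneg (by positivity)]
      exact min_le_left _ _
    have hwb : ∀ x, ‖w x‖ₑ ≤ ENNReal.ofReal m := fun x => by
      rw [Real.enorm_of_nonneg (by positivity)]
      exact ENNReal.ofReal_le_ofReal (min_le_right _ _)
    set I := ∫⁻ x in Ω, ‖w x‖ₑ ^ q with hI
    have hIt : I ≠ ∞ := by
      refine ((lintegral_mono fun x => ENNReal.rpow_le_rpow (hwb x) hq0.le).trans_lt ?_).ne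
      rw [setLIntegral_const]
      exact ENNReal.mul_lt_top (ENNReal.rpow_lt_top_of_nonneg hq0.le ENNReal.ofReal_ne_top)
        hΩ.lt_top
    rcases eq_or_ne I 0 with hI0 | hI0
    · rw [hI0, ENNReal.zero_rpow_of_pos (by positivity)]
      exact zero_le
    have hpt := hP w hwm (by rwa [hsupp w hw0]) (by rwa [hsupp w hw0])
    rw [hsupp w hw0, ← hI] at hpt
    have hI1 : I ^ (1 - 2 / q) ≠ 0 := by simp [ENNReal.rpow_eq_zero_iff, hI0, hIt]
    have hI2 : I ^ (1 - 2 / q) ≠ ∞ := ENNReal.rpow_ne_top_of_nonneg hq1.le hIt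
    have hint : I ≤ ENNReal.ofReal C * I ^ (1 - 2 / q) *
        ∫⁻ x in Ω, (‖w x‖ₑ ^ 2 + energyDensity K w x) := by
      rw [← lintegral_const_mul' _ _ (ENNReal.mul_ne_top ENNReal.ofReal_ne_top hI2)]
      exact lintegral_mono hpt
    have hIeq : I = I ^ (1 - 2 / q) * I ^ (2 / q) := by
      rw [← ENNReal.rpow_add _ _ hI0 hIt]; simp
    have hfin : I ^ (2 / q) ≤ ENNReal.ofReal C *
        ∫⁻ x in Ω, (‖w x‖ₑ ^ 2 + energyDensity K w x) := by
      rw [← ENNReal.mul_le_mul_iff_right hI1 hI2, ← hIeq]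
      refine hint.trans (le_of_eq ?_)
      ring
    refine hfin.trans ?_
    gcongr with x
    · exact hwu x
    · exact energyDensity_min_abs_le u m x
  have hlim : Tendsto (fun m : ℕ => ∫⁻ x in Ω, ‖min |u x| (m : ℝ)‖ₑ ^ q) atTop
      (𝓝 (∫⁻ x in Ω, ‖u x‖ₑ ^ q)) := by
    refine lintegral_tendsto_of_tendsto_of_monotone (fun m => ?_) ?_ ?_
    · exact (((measurable_norm.comp hu).min measurable_const).enorm.pow_const q).aemeasurable
    · refine Eventually.of_forall fun x m n hmn => ?_
      refine ENNReal.rpow_le_rpow ?_ hq0.le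
      rw [enorm_le_iff_norm_le, Real.norm_of_nonneg (by positivity),
        Real.norm_of_nonneg (by positivity)]
      gcongr
    · refine Eventually.of_forall fun x => tendsto_const_nhds.congr' ?_
      obtain ⟨m, hm⟩ := exists_nat_ge |u x|
      filter_upwards [eventually_ge_atTop m] with n hn
      rw [min_eq_left (hm.trans (by exact_mod_cast hn))]
      simp
  exact le_of_tendsto' ((ENNReal.continuous_rpow_const.tendsto _).comp hlim) hbdd

end Sobolev

/-! ### Hilbert space structure of `X₀`. -/

section SpaceX0

variable {N : ℕ} {K : RN N → ℝ} {Ω : Set (RN N)}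

theorem kernelMeasure_eq (hN : 0 < N)
    (hKmono : ∀ x y, x ≠ 0 → y ≠ 0 → ‖x‖ ≤ ‖y‖ → K y ≤ K x) :
    kernelMeasure K Ω = ((volume : Measure (RN N × RN N)).restrict (crossRegion Ω)).withDensity
      (fun p => kernelRep K (p.1 - p.2)) := by
  refine withDensity_congr_ae (ae_restrict_of_ae ?_)
  filter_upwards [ae_sub_ne_zero_RN hN] with p hp
  rw [kernelRep_eq hKmono hp]

theorem measurable_spaceX0 (g : spaceX0 K Ω) : Measurable (g.1 : RN N → ℝ) :=
  (AEEqFun.stronglyMeasurable g.1).measurable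

/-- The restriction `X₀ → L²(Ω)`. -/
noncomputable def restrictL2 (K : RN N → ℝ) (Ω : Set (RN N)) :
    spaceX0 K Ω →ₗ[ℝ] Lp ℝ 2 (volume.restrict Ω) where
  toFun g := g.2.1.1.toLp _
  map_add' f g := by
    rw [← MemLp.toLp_add]
    exact MemLp.toLp_congr _ _ (ae_restrict_of_ae (AEEqFun.coeFn_add f.1 g.1))
  map_smul' c g := by
    rw [RingHom.id_apply, ← MemLp.toLp_const_smul]
    exact MemLp.toLp_congr _ _ (ae_restrict_of_ae (AEEqFun.coeFn_smul c g.1))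

/-- The difference map `X₀ → L²(K(x - y) dx dy)`. -/
noncomputable def differenceL2 (K : RN N → ℝ) (Ω : Set (RN N)) :
    spaceX0 K Ω →ₗ[ℝ] Lp ℝ 2 (kernelMeasure K Ω) where
  toFun g := g.2.1.2.toLp _
  map_add' f g := by
    rw [← MemLp.toLp_add]
    exact MemLp.toLp_congr _ _ (diffFn_add f.1 g.1)
  map_smul' c g := by
    rw [RingHom.id_apply, ← MemLp.toLp_const_smul]
    exact MemLp.toLp_congr _ _ (diffFn_smul c g.1)

theorem restrictL2_coeFn (g : spaceX0 K Ω) : restrictL2 K Ω g =ᵐ[volume.restrict Ω] g.1 :=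
  g.2.1.1.coeFn_toLp

theorem differenceL2_coeFn (g : spaceX0 K Ω) :
    differenceL2 K Ω g =ᵐ[kernelMeasure K Ω] diffFn g.1 :=
  g.2.1.2.coeFn_toLp

theorem norm_sq_eq_innerX (g : spaceX0 K Ω) : ‖g‖ ^ 2 = innerX K Ω g.1 g.1 :=
  (real_inner_self_eq_norm_sq g).symm

/-- Restriction and difference together embed `X₀` isometrically in a sum of two `L²` spaces;
completeness and the energy bounds are read off from there. -/
theorem norm_sq_eq_add (g : spaceX0 K Ω) :
    ‖g‖ ^ 2 = ‖restrictL2 K Ω g‖ ^ 2 + ‖differenceL2 K Ω g‖ ^ 2 := by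
  rw [norm_sq_eq_innerX, ← real_inner_self_eq_norm_sq, ← real_inner_self_eq_norm_sq,
    L2.inner_def, L2.inner_def, innerX]
  congr 1
  · refine integral_congr_ae ?_
    filter_upwards [restrictL2_coeFn g] with x hx
    simp [hx, sq]
  · refine integral_congr_ae ?_
    filter_upwards [differenceL2_coeFn g] with x hx
    simp [hx, sq]

theorem norm_eq_normX (hN : 0 < N) (hKpos : ∀ x, x ≠ 0 → 0 < K x)
    (hKmono : ∀ x y, x ≠ 0 → y ≠ 0 → ‖x‖ ≤ ‖y‖ → K y ≤ K x) (g : spaceX0 K Ω) :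
    ‖g‖ = normX K Ω g.1 := by
  rw [normX, ← Real.sqrt_sq (norm_nonneg g), norm_sq_eq_innerX, innerX, kernelMeasure_eq hN hKmono]
  congr 2
  · simp only [sq]
  · rw [integral_withDensity_eq_integral_toReal_smul₀]
    · refine integral_congr_ae (ae_restrict_of_ae ?_)
      filter_upwards [ae_sub_ne_zero_RN hN] with p hp
      simp only [kernelRep_eq hKmono hp, ENNReal.toReal_ofReal (hKpos _ hp).le, diffFn, smul_eq_mul]
      ring
    · exact (measurable_kernelRep.comp (measurable_fst.sub measurable_snd)).aemeasurable
    · refine ae_restrict_of_ae ?_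
      filter_upwards [ae_sub_ne_zero_RN hN] with p hp
      rw [kernelRep_eq hKmono hp]
      exact ENNReal.ofReal_lt_top

theorem ofReal_norm_sq_L2 {α : Type*} [MeasurableSpace α] {μ : Measure α} (f : Lp ℝ 2 μ) :
    ENNReal.ofReal (‖f‖ ^ 2) = ∫⁻ x, ‖f x‖ₑ ^ 2 ∂μ := by
  rw [ENNReal.ofReal_pow (norm_nonneg _), ofReal_norm, Lp.enorm_def,
    eLpNorm_eq_lintegral_rpow_enorm_toReal two_ne_zero ENNReal.ofNat_ne_top,
    ← ENNReal.rpow_natCast, ← ENNReal.rpow_mul]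
  simp

/-- By Tonelli the left side integrates over `Ω × ℝ^N`, which lies in the cross region; the part
over `Ωᶜ × Ω` is dropped. -/
theorem lintegral_energyDensity_le (hN : 0 < N)
    (hKmono : ∀ x y, x ≠ 0 → y ≠ 0 → ‖x‖ ≤ ‖y‖ → K y ≤ K x) (g : spaceX0 K Ω) :
    ∫⁻ x in Ω, (‖(g.1 : RN N → ℝ) x‖ₑ ^ 2 + energyDensity K g.1 x) ≤
      ENNReal.ofReal (‖g‖ ^ 2) := by
  have hg := measurable_spaceX0 g
  have hκ : Measurable fun p : RN N × RN N => kernelRep K (p.1 - p.2) :=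
    measurable_kernelRep.comp (measurable_fst.sub measurable_snd)
  have hd : Measurable fun p : RN N × RN N => ‖diffFn g.1 p‖ₑ ^ 2 :=
    ((hg.comp measurable_fst).sub (hg.comp measurable_snd)).enorm.pow_const 2
  rw [norm_sq_eq_add, ENNReal.ofReal_add (by positivity) (by positivity), ofReal_norm_sq_L2,
    ofReal_norm_sq_L2, lintegral_add_left (hg.enorm.pow_const 2)]
  refine add_le_add (le_of_eq (lintegral_congr_ae ?_)) ?_
  · filter_upwards [restrictL2_coeFn g] with x hx
    rw [hx]
  have e : ∫⁻ p, ‖differenceL2 K Ω g p‖ₑ ^ 2 ∂(kernelMeasure K Ω) =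
      ∫⁻ p in crossRegion Ω, ‖diffFn g.1 p‖ₑ ^ 2 * kernelRep K (p.1 - p.2) := by
    have h : ∫⁻ p, ‖differenceL2 K Ω g p‖ₑ ^ 2 ∂(kernelMeasure K Ω) =
        ∫⁻ p, ‖diffFn g.1 p‖ₑ ^ 2 ∂(kernelMeasure K Ω) := by
      refine lintegral_congr_ae ?_
      filter_upwards [differenceL2_coeFn g] with p hp
      rw [hp]
    rw [h, kernelMeasure_eq hN hKmono, lintegral_withDensity_eq_lintegral_mul _ hκ hd]
    refine lintegral_congr fun p => ?_
    simp only [Pi.mul_apply, mul_comm]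
  rw [e]
  have hsub : Ω ×ˢ univ ⊆ crossRegion Ω := fun p hp hp' => hp'.1 hp.1
  refine le_trans (le_of_eq ?_) (lintegral_mono_set hsub)
  rw [Measure.volume_eq_prod, ← Measure.prod_restrict, lintegral_prod _ (hd.fun_mul hκ).aemeasurable,
    Measure.restrict_univ]
  rfl

theorem spaceX0_ext {f g : spaceX0 K Ω} (hΩ : MeasurableSet Ω)
    (h : (f.1 : RN N → ℝ) =ᵐ[volume.restrict Ω] g.1) : f = g := by
  refine Subtype.ext (AEEqFun.ext ?_)
  filter_upwards [(ae_restrict_iff' hΩ).1 h, f.2.2, g.2.2] with x h1 h2 h3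
  by_cases hx : x ∈ Ω
  · exact h1 hx
  · rw [h2 hx, h3 hx]

/-- Restrictions and differences converge in their `L²` spaces, to `F` and `G`. What needs proof is
that `G` is the difference of `F` extended by zero; this follows from convergence almost everywhere
along a subsequence, as the kernel measure is absolutely continuous. -/
theorem completeSpace_spaceX0 (hΩ : MeasurableSet Ω) : CompleteSpace (spaceX0 K Ω) := by
  refine Metric.complete_of_cauchySeq_tendsto fun u hu => ?_
  have h1 : ∀ g : spaceX0 K Ω, ‖restrictL2 K Ω g‖ ≤ 1 * ‖g‖ := fun g => by
    rw [one_mul]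
    refine (pow_le_pow_iff_left₀ (norm_nonneg _) (norm_nonneg _) two_ne_zero).1 ?_
    rw [norm_sq_eq_add g]
    exact le_add_of_nonneg_right (by positivity)
  have h2 : ∀ g : spaceX0 K Ω, ‖differenceL2 K Ω g‖ ≤ 1 * ‖g‖ := fun g => by
    rw [one_mul]
    refine (pow_le_pow_iff_left₀ (norm_nonneg _) (norm_nonneg _) two_ne_zero).1 ?_
    rw [norm_sq_eq_add g]
    exact le_add_of_nonneg_left (by positivity)
  obtain ⟨F, hF⟩ := cauchySeq_tendsto_of_complete
    (((restrictL2 K Ω).mkContinuous 1 h1).uniformContinuous.comp_cauchySeq hu)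
  obtain ⟨G, hG⟩ := cauchySeq_tendsto_of_complete
    (((differenceL2 K Ω).mkContinuous 1 h2).uniformContinuous.comp_cauchySeq hu)
  -- The second extraction is made inside the first, so both limits hold along `φ ∘ ψ`.
  obtain ⟨φ, hφ, hFae⟩ := (tendstoInMeasure_of_tendsto_Lp hF).exists_seq_tendsto_ae
  obtain ⟨ψ, hψ, hGae⟩ := (tendstoInMeasure_of_tendsto_Lp
    (hG.comp hφ.tendsto_atTop)).exists_seq_tendsto_ae
  have hg₀ : AEStronglyMeasurable (Ω.indicator F) volume :=
    (aestronglyMeasurable_indicator_iff hΩ).2 (Lp.aestronglyMeasurable F)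
  let g : RN N →ₘ[volume] ℝ := AEEqFun.mk _ hg₀
  have hg : g =ᵐ[volume] Ω.indicator F := AEEqFun.coeFn_mk _ _
  have hconv : ∀ᵐ x, Tendsto (fun n => ((u (φ n)).1 : RN N → ℝ) x) atTop (𝓝 (g x)) := by
    have hr : ∀ᵐ x ∂(volume.restrict Ω), ∀ n,
        restrictL2 K Ω (u (φ n)) x = ((u (φ n)).1 : RN N → ℝ) x :=
      ae_all_iff.2 fun n => restrictL2_coeFn _
    have hz : ∀ᵐ x, ∀ n, x ∈ Ωᶜ → ((u (φ n)).1 : RN N → ℝ) x = 0 :=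
      ae_all_iff.2 fun n => (u (φ n)).2.2
    filter_upwards [hg, (ae_restrict_iff' hΩ).1 hFae, (ae_restrict_iff' hΩ).1 hr, hz]
      with x hx1 hx2 hx3 hx4
    by_cases hx : x ∈ Ω
    · rw [hx1, indicator_of_mem hx]
      refine (hx2 hx).congr fun n => hx3 hx n
    · rw [hx1, indicator_of_notMem hx]
      exact tendsto_const_nhds.congr fun n => (hx4 n hx).symm
  have hdiff : diffFn g =ᵐ[kernelMeasure K Ω] G := by
    have hq1 := (Measure.quasiMeasurePreserving_fst (μ := (volume : Measure (RN N)))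
      (ν := (volume : Measure (RN N)))).ae hconv
    have hq2 := (Measure.quasiMeasurePreserving_snd (μ := (volume : Measure (RN N)))
      (ν := (volume : Measure (RN N)))).ae hconv
    have hr : ∀ᵐ p ∂(kernelMeasure K Ω), ∀ n,
        differenceL2 K Ω (u (φ n)) p = diffFn (u (φ n)).1 p :=
      ae_all_iff.2 fun n => differenceL2_coeFn _
    filter_upwards [kernelMeasure_ac.ae_le hq1, kernelMeasure_ac.ae_le hq2, hr, hGae]
      with p hp1 hp2 hp3 hp4
    refine tendsto_nhds_unique ((hp1.sub hp2).comp hψ.tendsto_atTop) (hp4.congr fun n => ?_)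
    exact hp3 (ψ n)
  have hgF : g =ᵐ[volume.restrict Ω] F := by
    filter_upwards [ae_restrict_of_ae hg, ae_restrict_mem hΩ] with x hx hxΩ
    rw [hx, indicator_of_mem hxΩ]
  have hgX : g ∈ spaceX0 K Ω := by
    refine ⟨⟨(memLp_congr_ae hgF).2 (Lp.memLp F), (memLp_congr_ae hdiff).2 (Lp.memLp G)⟩, ?_⟩
    filter_upwards [hg] with x hx hxΩ
    rw [hx, indicator_of_notMem hxΩ]
  refine ⟨⟨g, hgX⟩, ?_⟩
  have hJ1 : restrictL2 K Ω ⟨g, hgX⟩ = F := Lp.ext ((restrictL2_coeFn _).trans hgF)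
  have hJ2 : differenceL2 K Ω ⟨g, hgX⟩ = G := Lp.ext ((differenceL2_coeFn _).trans hdiff)
  rw [tendsto_iff_norm_sub_tendsto_zero]
  have hsq : Tendsto (fun n => ‖u n - ⟨g, hgX⟩‖ ^ 2) atTop (𝓝 0) := by
    simp only [norm_sq_eq_add, map_sub, hJ1, hJ2]
    have a1 := (tendsto_iff_norm_sub_tendsto_zero.1 hF).pow 2
    have a2 := (tendsto_iff_norm_sub_tendsto_zero.1 hG).pow 2
    simpa using a1.add a2
  simpa using hsq.sqrt

/-- A Sobolev inequality gives a continuous embedding. -/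
theorem SobolevInequality.embedsContinuously (hΩ : MeasurableSet Ω)
    (hn : ∀ g : spaceX0 K Ω, ‖g‖ = normX K Ω g.1) {q : ℝ≥0∞} [Fact (1 ≤ q)]
    (h : SobolevInequality K Ω q) : EmbedsContinuously K Ω q := by
  obtain ⟨C, hC, hS⟩ := h
  have hm : ∀ g : spaceX0 K Ω, MemLp g.1 q (volume.restrict Ω) := fun g =>
    ⟨(AEEqFun.stronglyMeasurable g.1).aestronglyMeasurable, (hS g).trans_lt ENNReal.ofReal_lt_top⟩
  let T₀ : spaceX0 K Ω →ₗ[ℝ] Lp ℝ q (volume.restrict Ω) :=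
    { toFun := fun g => (hm g).toLp _
      map_add' := fun f g => by
        rw [← MemLp.toLp_add]
        exact MemLp.toLp_congr _ _ (ae_restrict_of_ae (AEEqFun.coeFn_add f.1 g.1))
      map_smul' := fun c g => by
        rw [RingHom.id_apply, ← MemLp.toLp_const_smul]
        exact MemLp.toLp_congr _ _ (ae_restrict_of_ae (AEEqFun.coeFn_smul c g.1)) }
  have hT : ∀ g, T₀ g =ᵐ[volume.restrict Ω] g.1 := fun g => (hm g).coeFn_toLp
  refine ⟨T₀.mkContinuous C fun g => ?_, fun f g hfg => ?_, hT⟩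
  · rw [hn, Lp.norm_def, eLpNorm_congr_ae (hT g)]
    exact ENNReal.toReal_le_of_le_ofReal
      (mul_nonneg hC.le (Real.sqrt_nonneg _)) (hS g)
  · exact spaceX0_ext hΩ ((hT f).symm.trans ((Lp.ext_iff.1 hfg).trans (hT g)))

theorem SobolevInequality.mono (hΩ : volume Ω ≠ ∞) {p q : ℝ≥0∞} (hp : p ≠ 0) (hpq : p ≤ q)
    (h : SobolevInequality K Ω q) : SobolevInequality K Ω p := by
  obtain ⟨C, hC, hS⟩ := h
  set θ := 1 / p.toReal - 1 / q.toReal with hθ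
  have hθ0 : 0 ≤ θ := by
    rw [hθ, sub_nonneg]
    rcases eq_or_ne q ∞ with rfl | hq
    · simp
    · exact one_div_le_one_div_of_le (ENNReal.toReal_pos hp (ne_top_of_le_ne_top hq hpq))
        (ENNReal.toReal_mono hq hpq)
  have ht : volume Ω ^ θ ≠ ∞ := ENNReal.rpow_ne_top_of_nonneg hθ0 hΩ
  -- The factor `volume Ω ^ θ` is Hölder's; the added 1 keeps the constant positive when that factor
  -- vanishes.
  refine ⟨C * (volume Ω ^ θ).toReal + 1 , by positivity, fun g => ?_⟩
  have hm := (AEEqFun.stronglyMeasurable g.1).aestronglyMeasurable (μ := volume.restrict Ω)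
  refine (eLpNorm_le_eLpNorm_mul_rpow_measure_univ hpq hm).trans ?_
  rw [Measure.restrict_apply_univ, ← hθ]
  have h0 : 0 ≤ normX K Ω g.1 := Real.sqrt_nonneg _
  calc eLpNorm g.1 q (volume.restrict Ω) * volume Ω ^ θ
      ≤ ENNReal.ofReal (C * normX K Ω g.1) * ENNReal.ofReal (volume Ω ^ θ).toReal := by
        rw [ENNReal.ofReal_toReal ht]
        gcongr
        exact hS g
    _ = ENNReal.ofReal (C * normX K Ω g.1 * (volume Ω ^ θ).toReal) :=
        (ENNReal.ofReal_mul (by positivity)).symm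
    _ ≤ _ := by
        refine ENNReal.ofReal_le_ofReal ?_
        nlinarith

end SpaceX0

/-! ### Compact embeddings. -/

section Compactness

variable {N : ℕ} {K : RN N → ℝ} {Ω : Set (RN N)}

theorem sobolevInequality_two (hn : ∀ g : spaceX0 K Ω, ‖g‖ = normX K Ω g.1) :
    SobolevInequality K Ω 2 := by
  refine ⟨1, one_pos, fun g => ?_⟩
  rw [one_mul, ← hn, ← eLpNorm_congr_ae (restrictL2_coeFn g), ← Lp.enorm_def, ← ofReal_norm]
  refine ENNReal.ofReal_le_ofReal ?_
  refine (pow_le_pow_iff_left₀ (norm_nonneg _) (norm_nonneg _) two_ne_zero).1 ?_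
  rw [norm_sq_eq_add g]
  exact le_add_of_nonneg_right (by positivity)

/-- A function of `X₀` is close in `L²(Ω)` to its averages. -/
theorem norm_sub_average_sq_le (hN : 0 < N)
    (hKmono : ∀ x y, x ≠ 0 → y ≠ 0 → ‖x‖ ≤ ‖y‖ → K y ≤ K x)
    (hΩt : volume Ω ≠ ∞) {ρ : RN N → ℝ≥0∞} (hρ : Measurable ρ)
    (h1 : ∫⁻ y, ρ y = 1) {b m : ℝ≥0∞} (hbt : b ≠ ∞) (hb : ∀ y, ρ y ≤ b)
    (hm : ∀ y, ρ y ≤ m * kernelRep K y) (hmt : m ≠ ∞)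
    (A : Lp ℝ 2 (volume.restrict Ω) →L[ℝ] Lp ℝ 2 (volume.restrict Ω))
    (hA : ∀ f : Lp ℝ 2 (volume.restrict Ω), A f =ᵐ[volume.restrict Ω]
      fun x => ∫ y in Ω, (ρ (x - y)).toReal * f y) (g : spaceX0 K Ω) :
    ‖restrictL2 K Ω g - A (restrictL2 K Ω g)‖ ^ 2 ≤ m.toReal * ‖g‖ ^ 2 := by
  have : IsFiniteMeasure (volume.restrict Ω) := isFiniteMeasure_restrict.2 hΩt
  have hg := measurable_spaceX0 g
  have hρt : ∀ y, ρ y ≠ ∞ := fun y => ne_top_of_le_ne_top hbt (hb y)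
  have hgint : Integrable (g.1 : RN N → ℝ) volume := by
    have h : IntegrableOn (g.1 : RN N → ℝ) Ω := g.2.1.1.integrable one_le_two
    refine h.integrable_of_ae_notMem_eq_zero ?_
    filter_upwards [g.2.2] with x hx hxΩ using hx hxΩ
  have hpt : ∀ᵐ x ∂(volume.restrict Ω),
      ‖(restrictL2 K Ω g - A (restrictL2 K Ω g) : Lp ℝ 2 (volume.restrict Ω)) x‖ₑ ^ 2 ≤
        m * energyDensity K g.1 x := by
    filter_upwards [Lp.coeFn_sub (restrictL2 K Ω g) (A (restrictL2 K Ω g)), restrictL2_coeFn g,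
      hA (restrictL2 K Ω g)] with x hx1 hx2 hx3
    have hρm : Measurable fun y => ρ (x - y) := hρ.comp (measurable_const.sub measurable_id)
    have hρ1 : ∫⁻ y, ρ (x - y) = 1 := by rw [lintegral_sub_left_eq_self ρ x, h1]
    have i1 : ∫ y in Ω, (ρ (x - y)).toReal * restrictL2 K Ω g y =
        ∫ y, (ρ (x - y)).toReal * (g.1 : RN N → ℝ) y := by
      refine (integral_congr_ae ?_).trans (setIntegral_eq_integral_of_ae_compl_eq_zero ?_)
      · filter_upwards [restrictL2_coeFn g] with y hy
        rw [hy]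
      · filter_upwards [g.2.2] with y hy hyΩ
        rw [hy hyΩ, mul_zero]
    have i2 : Integrable fun y => (ρ (x - y)).toReal * (g.1 : RN N → ℝ) y := by
      refine hgint.bdd_mul hρm.ennreal_toReal.aestronglyMeasurable
        (Eventually.of_forall fun y => ?_) (c := b.toReal)
      rw [Real.norm_of_nonneg ENNReal.toReal_nonneg]
      exact ENNReal.toReal_mono hbt (hb _)
    have i3 : Integrable fun y => (ρ (x - y)).toReal :=
      integrable_toReal_of_lintegral_ne_top hρm.aemeasurable (by simp [hρ1])
    have i4 : ∫ y, (ρ (x - y)).toReal = 1 := by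
      rw [integral_toReal hρm.aemeasurable (Eventually.of_forall fun y => (hρt _).lt_top), hρ1,
        ENNReal.toReal_one]
    -- Since `ρ` has mass one and `g` vanishes off `Ω`, subtracting the average amounts to averaging
    -- the differences `g x - g y` over all of space.
    have e : (restrictL2 K Ω g - A (restrictL2 K Ω g) : Lp ℝ 2 (volume.restrict Ω)) x =
        ∫ y, (ρ (x - y)).toReal * ((g.1 : RN N → ℝ) x - (g.1 : RN N → ℝ) y) := by
      rw [hx1, Pi.sub_apply, hx2, hx3, i1]
      simp only [mul_sub]
      rw [integral_sub (i3.mul_const _) i2, integral_mul_const, i4, one_mul]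
    rw [e]
    have hle := (enorm_integral_le_lintegral_enorm fun y =>
      (ρ (x - y)).toReal * ((g.1 : RN N → ℝ) x - (g.1 : RN N → ℝ) y)).trans
        ((le_of_eq (lintegral_congr fun y => ?_)).trans
          (lintegral_averaging_sub_sq_le hρ h1 hm hg x))
    · refine (pow_le_pow_left₀ zero_le hle 2).trans (le_of_eq ?_)
      rw [← ENNReal.rpow_two, ← ENNReal.rpow_mul]
      simp
    · rw [enorm_mul, Real.enorm_of_nonneg ENNReal.toReal_nonneg, ENNReal.ofReal_toReal (hρt _)]
  rw [← ENNReal.ofReal_le_ofReal_iff (by positivity), ofReal_norm_sq_L2,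
    ENNReal.ofReal_mul ENNReal.toReal_nonneg, ENNReal.ofReal_toReal hmt]
  calc _ ≤ ∫⁻ x in Ω, m * energyDensity K g.1 x := lintegral_mono_ae hpt
    _ = m * ∫⁻ x in Ω, energyDensity K g.1 x := lintegral_const_mul _ (measurable_energyDensity hg)
    _ ≤ m * ENNReal.ofReal (‖g‖ ^ 2) := by
        gcongr
        refine le_trans (lintegral_mono fun x => ?_) (lintegral_energyDensity_le hN hKmono g)
        exact le_add_self

/-- If the tail of the kernel blows up at the origin, `X₀` embeds compactly into `L²(Ω)`. -/
theorem embedsCompactly_two (hN : 0 < N) (hKpos : ∀ x, x ≠ 0 → 0 < K x)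
    (hKint : Integrable (fun x => min (‖x‖ ^ 2) 1 * K x) volume)
    (hKmono : ∀ x y, x ≠ 0 → y ≠ 0 → ‖x‖ ≤ ‖y‖ → K y ≤ K x)
    (hΩ : MeasurableSet Ω) (hΩt : volume Ω ≠ ∞)
    (htail : Tendsto (kernelTail K) (𝓝[>] 0) (𝓝 ∞)) : EmbedsCompactly K Ω 2 := by
  have : IsFiniteMeasure (volume.restrict Ω) := isFiniteMeasure_restrict.2 hΩt
  have hn := norm_eq_normX (Ω := Ω) hN hKpos hKmono
  obtain ⟨T, hT⟩ := (sobolevInequality_two hn).embedsContinuously hΩ hn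
  refine ⟨T, hT, ?_⟩
  have hTr : ∀ g, T g = restrictL2 K Ω g := fun g =>
    Lp.ext ((hT.2 g).trans (restrictL2_coeFn g).symm)
  have hex : ∀ r : ℝ, ∃ A : Lp ℝ 2 (volume.restrict Ω) →L[ℝ] Lp ℝ 2 (volume.restrict Ω),
      0 < r → kernelTail K r ≠ 0 → IsCompactOperator A ∧ ∀ g : spaceX0 K Ω,
        ‖T g - A (T g)‖ ^ 2 ≤ ((kernelTail K r)⁻¹).toReal * ‖g‖ ^ 2 := fun r => by
    by_cases hr : 0 < r
    · obtain ⟨ρ, hρ, h1, hb, hm⟩ := exists_averaging_kernel hN hKpos hKint hKmono hr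
      have hbt : (volume (Metric.ball (0 : RN N) r))⁻¹ ≠ ∞ :=
        ENNReal.inv_ne_top.2 (Metric.measure_ball_pos volume _ hr).ne'
      have hk : Measurable (Function.uncurry fun x y : RN N => (ρ (x - y)).toReal) :=
        (hρ.comp (measurable_fst.sub measurable_snd)).ennreal_toReal
      obtain ⟨A, hAc, hA⟩ := exists_isCompactOperator_integral (μ := volume.restrict Ω) hk
        (B := ((volume (Metric.ball (0 : RN N) r))⁻¹).toReal) fun x y => by
          rw [Real.norm_of_nonneg ENNReal.toReal_nonneg]
          exact ENNReal.toReal_mono hbt (hb _)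
      refine ⟨A, fun _ h0 => ⟨hAc, fun g => ?_⟩⟩
      rw [hTr]
      exact norm_sub_average_sq_le hN hKmono hΩt hρ h1 hbt hb hm (ENNReal.inv_ne_top.2 h0) A hA g
    · exact ⟨0, fun h => absurd h hr⟩
  choose A hA using hex
  have hev : ∀ᶠ r : ℝ in 𝓝[>] 0, 0 < r ∧ kernelTail K r ≠ 0 := by
    filter_upwards [self_mem_nhdsWithin, htail.eventually (lt_mem_nhds ENNReal.zero_lt_top)]
      with r hr h0
    exact ⟨hr, h0.ne'⟩
  -- The distance from `T` to the compact operator `A r ∘ T` is at most `tail(r)^(-1/2)`, which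
  -- tends to 0.
  refine isCompactOperator_of_tendsto (F := fun r => (A r).comp T) (l := 𝓝[>] (0 : ℝ)) ?_ ?_
  · have hlim : Tendsto (fun r => √(((kernelTail K r)⁻¹).toReal)) (𝓝[>] 0) (𝓝 0) := by
      have h := (ENNReal.tendsto_toReal ENNReal.zero_ne_top).comp
        (ENNReal.inv_top ▸ (tendsto_inv_iff.2 htail))
      simpa using h.sqrt
    rw [tendsto_iff_norm_sub_tendsto_zero]
    refine squeeze_zero' (Eventually.of_forall fun r => norm_nonneg _) ?_ hlim
    filter_upwards [hev] with r hr
    refine ContinuousLinearMap.opNorm_le_bound _ (Real.sqrt_nonneg _) fun g => ?_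
    have h := (hA r hr.1 hr.2).2 g
    rw [← norm_neg, ← neg_apply, neg_sub]
    refine (pow_le_pow_iff_left₀ (norm_nonneg _) (by positivity) two_ne_zero).1 ?_
    rw [mul_pow, Real.sq_sqrt ENNReal.toReal_nonneg]
    exact h
  · filter_upwards [hev] with r hr
    exact (hA r hr.1 hr.2).1.comp_clm T

/-- Interpolation of Lebesgue norms between the exponents `2` and `p`. -/
theorem eLpNorm_le_eLpNorm_two_rpow_mul {α : Type*} [MeasurableSpace α] {μ : Measure α}
    {f : α → ℝ} (hf : AEMeasurable f μ) {q p : ℝ} (hq : 2 < q) (hqp : q < p) :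
    eLpNorm f (ENNReal.ofReal q) μ ≤ eLpNorm f 2 μ ^ (2 * ((p - q) / (p - 2)) / q) *
      eLpNorm f (ENNReal.ofReal p) μ ^ (p * ((q - 2) / (p - 2)) / q) := by
  have hq0 : 0 < q := by linarith
  have hp0 : 0 < p := by linarith
  have hp2 : 0 < p - 2 := by linarith
  -- Hölder weights with `θ + η = 1` and `2θ + pη = q`, so that `|f|^q = (|f|²)^θ (|f|^p)^η`.
  set θ := (p - q) / (p - 2) with hθ
  set η := (q - 2) / (p - 2) with hη
  have hθ0 : 0 ≤ θ := div_nonneg (by linarith) hp2.le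
  have hη0 : 0 ≤ η := div_nonneg (by linarith) hp2.le
  have hsum : θ + η = 1 := by rw [hθ, hη]; field_simp; ring
  have hexp : 2 * θ + p * η = q := by rw [hθ, hη]; field_simp; ring
  have h := ENNReal.lintegral_mul_norm_pow_le (μ := μ) (hf.enorm.pow_const (2 : ℝ))
    (hf.enorm.pow_const p) hθ0 hη0 hsum
  rw [eLpNorm_eq_lintegral_rpow_enorm_toReal (by simpa using hq0) ENNReal.ofReal_ne_top,
    eLpNorm_eq_lintegral_rpow_enorm_toReal two_ne_zero ENNReal.ofNat_ne_top,
    eLpNorm_eq_lintegral_rpow_enorm_toReal (by simpa using hp0) ENNReal.ofReal_ne_top,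
    ENNReal.toReal_ofReal hq0.le, ENNReal.toReal_ofReal hp0.le, ENNReal.toReal_ofNat,
    ← ENNReal.rpow_mul, ← ENNReal.rpow_mul]
  have e1 : (1 / 2 : ℝ) * (2 * θ / q) = θ * (1 / q) := by ring
  have e2 : 1 / p * (p * η / q) = η * (1 / q) := by field_simp
  rw [e1, e2, ENNReal.rpow_mul, ENNReal.rpow_mul, ← ENNReal.mul_rpow_of_nonneg _ _ (by positivity)]
  refine ENNReal.rpow_le_rpow ((le_of_eq (lintegral_congr fun x => ?_)).trans h) (by positivity)
  rw [← ENNReal.rpow_mul, ← ENNReal.rpow_mul, ← ENNReal.rpow_add_of_nonneg _ _ (by positivity)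
    (by positivity), hexp]

/-- A compact embedding into `L²(Ω)` and a Sobolev inequality with exponent `p` give a compact
embedding into `L^q(Ω)` for `q < p`. -/
theorem EmbedsCompactly.of_sobolevInequality (hΩ : MeasurableSet Ω) (hΩt : volume Ω ≠ ∞)
    (hn : ∀ g : spaceX0 K Ω, ‖g‖ = normX K Ω g.1) (h2 : EmbedsCompactly K Ω 2) {p : ℝ}
    (hp : 2 < p) (hS : SobolevInequality K Ω (ENNReal.ofReal p)) {q : ℝ≥0∞} [hq1 : Fact (1 ≤ q)]
    (hqp : q < ENNReal.ofReal p) : EmbedsCompactly K Ω q := by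
  have hq0 : q ≠ 0 := (zero_lt_one.trans_le hq1.out).ne'
  obtain ⟨T, hT⟩ := (hS.mono hΩt hq0 hqp.le).embedsContinuously hΩ hn
  obtain ⟨T₂, hT₂, hc⟩ := h2
  refine ⟨T, hT, ?_⟩
  have hTq : ∀ g, ‖T g‖ = (eLpNorm g.1 q (volume.restrict Ω)).toReal := fun g => by
    rw [Lp.norm_def, eLpNorm_congr_ae (hT.2 g)]
  have hT2 : ∀ g, ‖T₂ g‖ = (eLpNorm g.1 2 (volume.restrict Ω)).toReal := fun g => by
    rw [Lp.norm_def, eLpNorm_congr_ae (hT₂.2 g)]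
  -- For `q ≤ 2` the `L²` norm alone controls `T` by Hölder (exponents 1 and 0). For `q > 2` the
  -- `L^p` norm is interpolated with it, and the power of the `L²` norm is positive because `q < p`.
  rcases le_or_gt q 2 with hq2 | hq2
  · have hqt : q ≠ ∞ := ne_top_of_le_ne_top ENNReal.ofNat_ne_top hq2
    have hθ : 0 ≤ 1 / q.toReal - 1 / (2 : ℝ≥0∞).toReal :=
      sub_nonneg.2 (one_div_le_one_div_of_le (ENNReal.toReal_pos hq0 hqt)
        (ENNReal.toReal_mono ENNReal.ofNat_ne_top hq2))
    have ht := ENNReal.rpow_ne_top_of_nonneg hθ hΩt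
    refine hc.of_interpolation T (C := (volume Ω ^ (1 / q.toReal - 1 / (2 : ℝ≥0∞).toReal)).toReal)
      ENNReal.toReal_nonneg one_pos le_rfl fun g => ?_
    rw [Real.rpow_one, Real.rpow_zero, mul_one, hTq, hT2, ← ENNReal.toReal_mul, mul_comm]
    have h := eLpNorm_le_eLpNorm_mul_rpow_measure_univ hq2 g.2.1.1.1
    rw [Measure.restrict_apply_univ] at h
    exact ENNReal.toReal_mono (ENNReal.mul_ne_top g.2.1.1.2.ne ht) h
  · have hqt : q ≠ ∞ := (hqp.trans ENNReal.ofReal_lt_top).ne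
    have hq2' : 2 < q.toReal := by
      simpa using (ENNReal.toReal_lt_toReal ENNReal.ofNat_ne_top hqt).2 hq2
    have hqp' : q.toReal < p := by
      have := (ENNReal.toReal_lt_toReal hqt ENNReal.ofReal_ne_top).2 hqp
      rwa [ENNReal.toReal_ofReal (by linarith)] at this
    obtain ⟨C, hC, hCS⟩ := hS
    have hp2 : 0 < p - 2 := by linarith
    have hpq : 0 < p - q.toReal := by linarith
    have hq2'' : 0 < q.toReal - 2 := by linarith
    have ha : 0 < 2 * ((p - q.toReal) / (p - 2)) / q.toReal := by positivity
    have hb : 0 ≤ p * ((q.toReal - 2) / (p - 2)) / q.toReal := by positivity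
    refine hc.of_interpolation T (C := C ^ (p * ((q.toReal - 2) / (p - 2)) / q.toReal))
      (by positivity) ha hb fun g => ?_
    have h := eLpNorm_le_eLpNorm_two_rpow_mul (μ := volume.restrict Ω)
      (measurable_spaceX0 g).aemeasurable hq2' hqp'
    rw [ENNReal.ofReal_toReal hqt] at h
    have h' := h.trans (mul_le_mul' le_rfl (ENNReal.rpow_le_rpow (hCS g) hb))
    have h'' := ENNReal.toReal_mono (ENNReal.mul_ne_top
      (ENNReal.rpow_ne_top_of_nonneg ha.le g.2.1.1.2.ne)
      (ENNReal.rpow_ne_top_of_nonneg hb ENNReal.ofReal_ne_top)) h'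
    rw [ENNReal.toReal_mul, ← ENNReal.toReal_rpow, ← ENNReal.toReal_rpow, ← hT2, ← hTq, ← hn,
      ENNReal.toReal_ofReal (by positivity), Real.mul_rpow hC.le (norm_nonneg _)] at h''
    exact h''.trans (le_of_eq (by ring))

end Compactness

/-! ### From the order of the kernel to tail bounds. -/

section Order

variable {N : ℕ} {K : RN N → ℝ} {Ω : Set (RN N)}

theorem scaledTail_zero (r : ℝ) : scaledTail K 0 r = kernelTail K r := by
  simp [scaledTail]

/-- For `r < 1` lowering the exponent increases `r^(2s)`, so divergence passes from some `s' > s` in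
the defining set down to `s`. That set is nonempty because `sSup ∅ = 0`. -/
theorem tendsto_scaledTail_of_lt_kernelOrder (h0 : 0 < kernelOrder K) {s : ℝ}
    (hs : s < kernelOrder K) : Tendsto (fun r => scaledTail K s r) (𝓝[>] 0) (𝓝 ∞) := by
  have hne : {s : ℝ | 0 ≤ s ∧ Tendsto (fun r : ℝ => scaledTail K s r) (𝓝[>] 0) (𝓝 ∞)}.Nonempty := by
    by_contra h
    rw [kernelOrder, not_nonempty_iff_eq_empty.1 h, Real.sSup_empty] at h0
    exact lt_irrefl _ h0
  obtain ⟨s', ⟨-, hs'⟩, hlt⟩ := exists_lt_of_lt_csSup hne hs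
  refine tendsto_nhds_top_mono hs' ?_
  filter_upwards [Ioo_mem_nhdsGT (zero_lt_one (α := ℝ))] with r hr
  refine mul_le_mul' (ENNReal.ofReal_le_ofReal ?_) le_rfl
  exact Real.rpow_le_rpow_of_exponent_ge hr.1 hr.2.le (by linarith)

theorem exists_le_kernelTail {s c : ℝ}
    (h : ∀ᶠ r in 𝓝[>] 0, ENNReal.ofReal c ≤ scaledTail K s r) :
    ∃ r₀ : ℝ, 0 < r₀ ∧ ∀ r, 0 < r → r < r₀ →
      ENNReal.ofReal (c * r ^ (-(2 * s))) ≤ kernelTail K r := by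
  obtain ⟨r₀, hr₀, hsub⟩ := mem_nhdsGT_iff_exists_Ioo_subset.1 h
  refine ⟨r₀, hr₀, fun r hr hrr => ?_⟩
  have h1 : ENNReal.ofReal c ≤ ENNReal.ofReal (r ^ (2 * s)) * kernelTail K r := hsub ⟨hr, hrr⟩
  have hpos : 0 < r ^ (2 * s) := Real.rpow_pos_of_pos hr _
  rw [Real.rpow_neg hr.le, ← div_eq_mul_inv, ENNReal.ofReal_div_of_pos hpos]
  exact ENNReal.div_le_of_le_mul' h1

theorem sobolevInequality_of_kernelTail (hN : 0 < N) (hKpos : ∀ x, x ≠ 0 → 0 < K x)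
    (hKint : Integrable (fun x => min (‖x‖ ^ 2) 1 * K x) volume)
    (hKmono : ∀ x y, x ≠ 0 → y ≠ 0 → ‖x‖ ≤ ‖y‖ → K y ≤ K x)
    (hΩ : MeasurableSet Ω) (hΩt : volume Ω ≠ ∞) {s c r₀ : ℝ} (hs : 0 < s) (hsN : 2 * s < N)
    (hc : 0 < c) (hr₀ : 0 < r₀)
    (hK : ∀ r, 0 < r → r < r₀ → ENNReal.ofReal (c * r ^ (-(2 * s))) ≤ kernelTail K r) :
    SobolevInequality K Ω (ENNReal.ofReal (2 * N / (N - 2 * s))) := by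
  have hN' : (0 : ℝ) < N := Nat.cast_pos.2 hN
  have hNs : (0 : ℝ) < N - 2 * s := by linarith
  set q : ℝ := 2 * N / (N - 2 * s) with hq
  have hq2 : 2 < q := by rw [hq, lt_div_iff₀ hNs]; linarith
  have hq0 : 0 < q := by linarith
  have hqs : 1 / q = 1 / 2 - s / N := by rw [hq]; field_simp
  obtain ⟨C, hC, h⟩ := exists_sobolev_of_tail hN hKpos hKint hKmono hs hq2 hqs hc hr₀ hK hΩ hΩt
  refine ⟨√C + 1, by positivity, fun g => ?_⟩
  rw [← norm_eq_normX hN hKpos hKmono]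
  have h1 := (h g.1 (measurable_spaceX0 g) g.2.2).trans
    (mul_le_mul' le_rfl (lintegral_energyDensity_le hN hKmono g))
  rw [← ENNReal.ofReal_mul hC] at h1
  have h2 := ENNReal.rpow_le_rpow h1 (z := 1 / 2) (by norm_num)
  rw [← ENNReal.rpow_mul, ENNReal.ofReal_rpow_of_nonneg (by positivity) (by norm_num),
    ← Real.sqrt_eq_rpow, Real.sqrt_mul hC, Real.sqrt_sq (norm_nonneg g)] at h2
  rw [eLpNorm_eq_lintegral_rpow_enorm_toReal (by simpa using hq0) ENNReal.ofReal_ne_top,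
    ENNReal.toReal_ofReal hq0.le]
  have e : 2 / q * (1 / 2) = 1 / q := by ring
  rw [e] at h2
  refine h2.trans (ENNReal.ofReal_le_ofReal ?_)
  gcongr
  linarith

theorem critExp_eq {s : ℝ} (hs : 2 * s < N) : critExp N s = ENNReal.ofReal (2 * N / (N - 2 * s)) :=
  (ENNReal.ofReal_div_of_pos (by linarith)).symm

/-- Cleared of denominators, `q (N - 2s) < 2N` is an open condition on `s` that also makes sense at
`N = 2s₀`, where the critical exponent is `∞`. -/
theorem exists_lt_of_lt_critExp {s₀ : ℝ} (hN : 0 < N) (hs₀ : 0 < s₀) (hsN : 2 * s₀ ≤ N) {q : ℝ≥0∞}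
    (hq : q < critExp N s₀) :
    ∃ s, 0 < s ∧ s < s₀ ∧ q < ENNReal.ofReal (2 * N / (N - 2 * s)) := by
  have hN' : (0 : ℝ) < N := Nat.cast_pos.2 hN
  have hqt : q ≠ ∞ := hq.ne_top
  have h : q.toReal * (N - 2 * s₀) < 2 * N := by
    rcases hsN.eq_or_lt with h | h
    · rw [h, sub_self, mul_zero]; positivity
    · rw [critExp_eq h, ← ENNReal.ofReal_toReal hqt, ENNReal.ofReal_lt_ofReal_iff_of_nonneg
        ENNReal.toReal_nonneg, lt_div_iff₀ (by linarith)] at hq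
      exact hq
  have hcont : Continuous fun s : ℝ => q.toReal * (N - 2 * s) := by fun_prop
  have hev : ∀ᶠ s in 𝓝[<] s₀, q.toReal * (N - 2 * s) < 2 * N :=
    (hcont.tendsto s₀).mono_left nhdsWithin_le_nhds |>.eventually (gt_mem_nhds h)
  obtain ⟨s, hs, hs'⟩ := (hev.and (Ioo_mem_nhdsLT hs₀)).exists
  refine ⟨s, hs'.1, hs'.2, ?_⟩
  rw [← ENNReal.ofReal_toReal hqt, ENNReal.ofReal_lt_ofReal_iff_of_nonneg ENNReal.toReal_nonneg,
    lt_div_iff₀ (by linarith [hs'.2])]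
  exact hs

/-- `r² ∫_{B_rᶜ} K → 0`. -/
theorem tendsto_scaledTail_one (hN : 0 < N)
    (hKint : Integrable (fun x => min (‖x‖ ^ 2) 1 * K x) volume)
    (hKmono : ∀ x y, x ≠ 0 → y ≠ 0 → ‖x‖ ≤ ‖y‖ → K y ≤ K x) :
    Tendsto (fun r => scaledTail K 1 r) (𝓝[>] 0) (𝓝 0) := by
  have hrep : ∀ r, scaledTail K 1 r = ∫⁻ y, (Metric.ball (0 : RN N) r)ᶜ.indicator
      (fun y => ENNReal.ofReal (r ^ 2) * kernelRep K y) y := fun r => by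
    rw [lintegral_indicator Metric.isOpen_ball.measurableSet.compl,
      lintegral_const_mul _ measurable_kernelRep, ← kernelTail_eq hN hKmono, scaledTail, mul_one,
      Real.rpow_two]
  simp only [hrep]
  rw [← lintegral_zero (μ := (volume : Measure (RN N)))]
  -- For `r < 1` and `|y| ≥ r`, `r² ≤ min(|y|², 1)`, which gives the integrable majorant.
  refine tendsto_lintegral_filter_of_dominated_convergence
    (fun x => ENNReal.ofReal (min (‖x‖ ^ 2) 1 * K x)) (Eventually.of_forall fun r => ?_) ?_
    hKint.lintegral_lt_top.ne ?_
  · exact (measurable_kernelRep.const_mul _).indicator Metric.isOpen_ball.measurableSet.compl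
  · filter_upwards [Ioo_mem_nhdsGT (zero_lt_one (α := ℝ))] with r hr
    filter_upwards [ae_ne_zero_RN hN] with y hy
    by_cases hyr : y ∈ (Metric.ball (0 : RN N) r)ᶜ
    · rw [indicator_of_mem hyr, kernelRep_eq hKmono hy, ENNReal.ofReal_mul (by positivity)]
      have hy' : r ≤ ‖y‖ := by simpa using hyr
      have hr0 := hr.1
      refine mul_le_mul' (ENNReal.ofReal_le_ofReal (le_min (by gcongr) ?_)) le_rfl
      exact pow_le_one₀ hr.1.le hr.2.le
    · rw [indicator_of_notMem hyr]
      exact zero_le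
  · filter_upwards [ae_ne_zero_RN hN] with y hy
    refine tendsto_of_tendsto_of_tendsto_of_le_of_le tendsto_const_nhds
      (h := fun r => ENNReal.ofReal (r ^ 2) * kernelRep K y) ?_ (fun r => zero_le)
      fun r => indicator_le_self _ _ y
    have h1 : Tendsto (fun r : ℝ => ENNReal.ofReal (r ^ 2)) (𝓝[>] 0) (𝓝 0) := by
      have hc : Continuous fun r : ℝ => ENNReal.ofReal (r ^ 2) :=
        ENNReal.continuous_ofReal.comp (continuous_pow 2)
      simpa using (hc.tendsto 0).mono_left nhdsWithin_le_nhds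
    have h2 := ENNReal.Tendsto.mul_const h1 (b := kernelRep K y)
      (Or.inr (by rw [kernelRep_eq hKmono hy]; exact ENNReal.ofReal_ne_top))
    simpa using h2

/-- At order one, `l_∞` would be the limit of `r² tail(r)`, which is 0. -/
theorem kernelOrder_lt_one (hN : 0 < N)
    (hKint : Integrable (fun x => min (‖x‖ ^ 2) 1 * K x) volume)
    (hKmono : ∀ x y, x ≠ 0 → y ≠ 0 → ‖x‖ ≤ ‖y‖ → K y ≤ K x) (h1 : kernelOrder K ≤ 1)
    (hlim : 0 < kernelLimit K) : kernelOrder K < 1 := by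
  refine lt_of_le_of_ne h1 fun h => hlim.ne' ?_
  rw [kernelLimit, h]
  exact (tendsto_scaledTail_one hN hKint hKmono).liminf_eq

end Order

/-! ### The embedding theorem. -/

theorem theorem1p1 (N : ℕ) (hN : 2 ≤ N)
    (Ω : Set (RN N)) (hΩo : IsOpen Ω) (hΩb : Bornology.IsBounded Ω)
    (K : RN N → ℝ)
    (hKpos : ∀ x, x ≠ 0 → 0 < K x)
    (hKint : Integrable (fun x => min (‖x‖ ^ 2) 1 * K x) volume)
    (hKmono : ∀ x y, x ≠ 0 → y ≠ 0 → ‖x‖ ≤ ‖y‖ → K y ≤ K x)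
    (hs : kernelOrder K ∈ Set.Ioc (0 : ℝ) 1) :
    ((∀ g : spaceX0 K Ω, ‖g‖ = normX K Ω g.1) ∧ CompleteSpace (spaceX0 K Ω)) ∧
    (kernelLimit K = 0 →
      ∀ (q : ℝ≥0∞) [Fact (1 ≤ q)], q < critExp N (kernelOrder K) →
        EmbedsCompactly K Ω q ∧ SobolevInequality K Ω q) ∧
    (0 < kernelLimit K →
      (∀ (q : ℝ≥0∞) [Fact (1 ≤ q)], q ≤ critExp N (kernelOrder K) →
        EmbedsContinuously K Ω q ∧ SobolevInequality K Ω q) ∧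
      (∀ (q : ℝ≥0∞) [Fact (1 ≤ q)], q < critExp N (kernelOrder K) →
        EmbedsCompactly K Ω q)) := by
  have hN0 : 0 < N := by omega
  have hN2 : (2 : ℝ) ≤ N := by exact_mod_cast hN
  have hΩ : MeasurableSet Ω := hΩo.measurableSet
  have hΩt : volume Ω ≠ ∞ := hΩb.measure_lt_top.ne
  have hn := norm_eq_normX (Ω := Ω) hN0 hKpos hKmono
  have htail : Tendsto (kernelTail K) (𝓝[>] 0) (𝓝 ∞) := by
    simpa only [scaledTail_zero] using tendsto_scaledTail_of_lt_kernelOrder hs.1 hs.1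
  have h2 := embedsCompactly_two hN0 hKpos hKint hKmono hΩ hΩt htail
  -- The subcritical statement does not involve `l_∞`: some `s < s₀` already has critical exponent
  -- above `q`, and its scaled tail diverges.
  have hsub : ∀ (q : ℝ≥0∞) [Fact (1 ≤ q)], q < critExp N (kernelOrder K) →
      EmbedsCompactly K Ω q ∧ SobolevInequality K Ω q := fun q hq1 hq => by
    obtain ⟨s, hs0, hss, hqs⟩ := exists_lt_of_lt_critExp hN0 hs.1 (by linarith [hs.2]) hq
    have hsN : 2 * s < N := by linarith [hs.2]
    obtain ⟨r₀, hr₀, hK⟩ := exists_le_kernelTail (K := K) (s := s) (c := 1)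
      ((tendsto_scaledTail_of_lt_kernelOrder hs.1 hss).eventually
        (le_mem_nhds ENNReal.ofReal_lt_top))
    have hS := sobolevInequality_of_kernelTail hN0 hKpos hKint hKmono hΩ hΩt hs0 hsN one_pos hr₀ hK
    refine ⟨h2.of_sobolevInequality hΩ hΩt hn ?_ hS hqs,
      hS.mono hΩt (zero_lt_one.trans_le hq1.out).ne' hqs.le⟩
    rw [lt_div_iff₀ (by linarith)]
    linarith
  refine ⟨⟨hn, completeSpace_spaceX0 hΩ⟩, fun _ => hsub, fun hl => ⟨fun q hq1 hq => ?_,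
    fun q _ hq => (hsub q hq).1⟩⟩
  have hlt := kernelOrder_lt_one hN0 hKint hKmono hs.2 hl
  have hsN : 2 * kernelOrder K < N := by linarith
  -- Any finite `c` strictly between 0 and the lower limit bounds the scaled tail from below near 0,
  -- also when `l_∞ = ∞`.
  obtain ⟨c, hc0, hcl⟩ := ENNReal.lt_iff_exists_nnreal_btwn.1 hl
  obtain ⟨r₀, hr₀, hK⟩ := exists_le_kernelTail (K := K) (s := kernelOrder K) (c := c) (by
    filter_upwards [eventually_lt_of_lt_liminf hcl] with r hr
    rw [ENNReal.ofReal_coe_nnreal]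
    exact hr.le)
  have hS := sobolevInequality_of_kernelTail hN0 hKpos hKint hKmono hΩ hΩt hs.1 hsN
    (NNReal.coe_pos.2 (by exact_mod_cast hc0)) hr₀ hK
  rw [critExp_eq hsN] at hq
  have hSq := hS.mono hΩt (zero_lt_one.trans_le hq1.out).ne' hq
  exact ⟨hSq.embedsContinuously hΩ hn, hSq⟩
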